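/- Let $n\ge 2$. Let $\otimes$ be an $n$-ary function symbol, let $\mathcal V$ be an infinite set of variables, let $\mathbb F_\otimes(\mathcal V)$ be the absolutely free algebra of terms built from $\otimes$ over $\mathcal V$, and fix distinct variables $x_1,\dots,x_{2n-1}\in\mathcal V$. The theory $C_n$ of $n$-catalan algebras consists of the equations, one for each $0<i<n$, $$\otimes(x_1,\dots,x_i,\otimes(x_{i+1},\dots,x_{i+n}),x_{i+n+1},\dots,x_{2n-1})=\otimes(x_1,\dots,x_{i-1},\otimes(x_i,\dots,x_{i+n-1}),x_{i+n},\dots,x_{2n-1}).$$ For terms $s,t$ with the same variables, let $\rho_{s,t}$ be the partial function on $\mathbb F_\otimes(\mathcal V)$ with graph $\{(s^\varphi,t^\varphi)\mid \varphi:\mathcal V\to\mathbb F_\otimes(\mathcal V)\}$, where $s^\varphi$ is the result of substituting $\varphi$ in $s$. For an address $\alpha$ (a path from the root in a term tree) let $\rho_{s,t}^\alpha$ be the partial function that applies $\rho_{s,t}$ to the subterm at address $\alpha$ and leaves the rest of the term unchanged. The structure monoid $\mathrm{Struct}(C_n)$ is the monoid of partial functions on $\mathbb F_\otimes(\mathcal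 V)$ generated, under composition (with $f\cdot g$ meaning $f$ followed by $g$), by all $\rho_{s,t}^\alpha$ with $(s,t)$ or $(t,s)$ an equation of $C_n$. The structure group $\mathrm{Struct}_G(C_n)$ is the quotient of $\mathrm{Struct}(C_n)$ by the congruence generated by identifying all idempotents with $1$; it is a group. A seed of a partial function $\rho$ on $\mathbb F_\otimes(\mathcal V)$ is a pair of terms $(s,t)$ such that the graph of $\rho$ is $\{(s^\varphi,t^\varphi)\mid\varphi:\mathcal V\to\mathbb F_\otimes(\mathcal V)\}$. For a term $t$, let $T(t)$ be the $n$-ary tree obtained from its term tree by forgetting the variables that label the leaves. An $n$-ary tree diagram is a triple $(T_1,T_2,\sigma)$ of two finite rooted $n$-ary trees and a bijection $\sigma$ from the leaves of $T_1$ to the leaves of $T_2$. A simple expansion of it attaches $n$ new leaves $\alpha_1(l),\dots,\alpha_n(l)$ to a leaf $l$ of $T_1$ and $\alpha_1(\sigma(l)),\dots,\alpha_n(\sigma(l))$ to the leaf $\sigma(l)$ of $T_2$, and replaces $l\mapsto\sigma(l)$ by $\alpha_i(l)\mapsto\alpha_i(\sigma(l))$. Two tree diagrams are equivalent if they have a common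 expansion, an expansion being the result of finitely many successive simple expansions; the class of $(T_1,T_2,\sigma)$ is the tree symbol $[(T_1,T_2,\sigma)]$. The tree symbols form the group $G_{n,1}$ with product $[(T_1,T,\sigma)][(T,T_2,\tau)]=[(T_1,T_2,\sigma\cdot\tau)]$, where $\sigma\cdot\tau$ is $\sigma$ followed by $\tau$. The Brown–Thompson group $F_{n,1}$ is the subgroup of the tree symbols $[(T_1,T_2,\sigma)]$ for which $\sigma$ preserves the lexicographic (left-to-right) order of the leaves. **Theorem.** Every $\rho\in\mathrm{Struct}(C_n)$ has a seed, and there is a group isomorphism $$\Theta:\mathrm{Struct}_G(C_n)\longrightarrow F_{n,1}$$ such that for every $\rho\in\mathrm{Struct}(C_n)$ and every seed $(s,t)$ of $\rho$, the trees $T(s)$ and $T(t)$ have the same number of leaves and $\Theta$ sends the class of $\rho$ to $[(T(s),T(t),\mathrm{id})]$, where $\mathrm{id}$ is the unique order-preserving bijection from the leaves of $T(s)$ to those of $T(t)$. -/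

import Mathlib

/-! ### Partial endomorphisms -/

/-- Partial functions from a type to itself. -/
def PartialEndo (X : Type*) : Type _ := X →. X

/-- Partial endomorphisms form a monoid under composition; `f * g` is `f` followed by `g`. -/
instance PartialEndo.instMonoid (X : Type*) : Monoid (PartialEndo X) where
  mul f g := PFun.comp g f
  one := PFun.id X
  mul_assoc f g h := (PFun.comp_assoc h g f).symm
  one_mul f := PFun.comp_id f
  mul_one f := PFun.id_comp f

/-- `f.Maps u v`: the partial function `f` is defined at `u`, with value `v`;
in other words `(u, v)` is in the graph of `f`. -/
def PartialEndo.Maps {X : Type*} (f : PartialEndo X) (u v : X) : Prop :=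
  v ∈ (show X →. X from f) u

theorem PartialEndo.ext_maps {X : Type*} {f g : PartialEndo X}
    (h : ∀ u v, f.Maps u v ↔ g.Maps u v) : f = g :=
  PFun.ext h

theorem PartialEndo.maps_mul {X : Type*} {f g : PartialEndo X} {u v : X} :
    (f * g).Maps u v ↔ ∃ w, f.Maps u w ∧ g.Maps w v :=
  Part.mem_bind_iff

theorem PartialEndo.maps_one {X : Type*} {u v : X} :
    (1 : PartialEndo X).Maps u v ↔ v = u :=
  Part.mem_some_iff

open Classical in
/-- The partial function whose graph is a given functional relation. -/
noncomputable def PartialEndo.ofGraph {X : Type*} (R : X → X → Prop) : PartialEndo X :=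
  fun u => ⟨∃ v, R u v, fun h => h.choose⟩

theorem PartialEndo.maps_ofGraph {X : Type*} {R : X → X → Prop}
    (hR : ∀ u v w, R u v → R u w → v = w) {u v : X} :
    (PartialEndo.ofGraph R).Maps u v ↔ R u v := by
  constructor
  · rintro ⟨h, rfl⟩
    exact h.choose_spec
  · intro h
    exact ⟨⟨v, h⟩, hR _ _ _ (Exists.choose_spec (⟨v, h⟩ : ∃ v, R u v)) h⟩

/-! ### Equational theories and their structure monoids -/

section Structure

universe u v w

/-- Addresses: words in the letters `(F, i)`, with `F` a function symbol and `i` one of its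
argument positions. -/
abbrev TermAddress (L : FirstOrder.Language.{u, v}) : Type u := List (Σ k : ℕ, L.Functions k × Fin k)

/-- The graph of the operator `ρ_{s,t}`: all pairs `(s^φ, t^φ)` with `φ` a substitution. -/
def SubstGraph {L : FirstOrder.Language.{u, v}} {V : Type w} (s t : L.Term V) (a b : L.Term V) : Prop :=
  ∃ φ : V → L.Term V, s.subst φ = a ∧ t.subst φ = b

/-- The graph of the translate of a partial function (given by its graph `R`) to an address:
`R` is applied to the subterm at that address, and everything else is left unchanged. -/
inductive TranslatedGraph {L : FirstOrder.Language.{u, v}} {V : Type w}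
    (R : L.Term V → L.Term V → Prop) : TermAddress L → L.Term V → L.Term V → Prop
  | root {a b : L.Term V} : R a b → TranslatedGraph R [] a b
  | step {k : ℕ} (f : L.Functions k) (i : Fin k) {α : TermAddress L}
      (args : Fin k → L.Term V) {b : L.Term V} : TranslatedGraph R α (args i) b →
      TranslatedGraph R (⟨k, f, i⟩ :: α) (FirstOrder.Language.Term.func f args)
        (FirstOrder.Language.Term.func f (Function.update args i b))

/-- The operator `ρ_{s,t}^α`. -/
noncomputable def translatedOp {L : FirstOrder.Language.{u, v}} {V : Type w} (s t : L.Term V)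
    (α : TermAddress L) : PartialEndo (L.Term V) :=
  PartialEndo.ofGraph (TranslatedGraph (SubstGraph s t) α)

/-- A seed of a partial function `ρ` on terms: a pair `(s, t)` such that the graph of `ρ` is the
set of all `(s^φ, t^φ)`, with `φ` a substitution. -/
def IsSeed {L : FirstOrder.Language.{u, v}} {V : Type w} (ρ : PartialEndo (L.Term V))
    (s t : L.Term V) : Prop :=
  ∀ a b, ρ.Maps a b ↔ SubstGraph s t a b

open Classical in
/-- A balanced equational theory in the function symbols of `L` and the variables `V`:
a set of pairs of terms, the two members of each pair having the same support. -/
structure BalancedTheory (L : FirstOrder.Language.{u, v}) (V : Type w) where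
  eqns : Set (L.Term V × L.Term V)
  balanced : ∀ p ∈ eqns, p.1.varFinset = p.2.varFinset

open Classical in
theorem subst_eq_of_varFinset {L : FirstOrder.Language.{u, v}} {V : Type w} {φ ψ : V → L.Term V}
    (s : L.Term V) (h : s.subst φ = s.subst ψ) : ∀ x ∈ s.varFinset, φ x = ψ x := by
  induction s with
  | var y => simpa [FirstOrder.Language.Term.subst] using h
  | func f ts ih =>
    simp only [FirstOrder.Language.Term.subst, FirstOrder.Language.Term.func.injEq, heq_eq_eq, true_and] at h
    intro x hx
    simp only [FirstOrder.Language.Term.varFinset, Finset.mem_biUnion, Finset.mem_univ, true_and] at hx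
    obtain ⟨i, hi⟩ := hx
    exact ih i (congrFun h i) x hi

open Classical in
theorem subst_congr_of_varFinset {L : FirstOrder.Language.{u, v}} {V : Type w} {φ ψ : V → L.Term V}
    (s : L.Term V) (h : ∀ x ∈ s.varFinset, φ x = ψ x) : s.subst φ = s.subst ψ := by
  induction s with
  | var y => simpa [FirstOrder.Language.Term.subst] using h
  | func f ts ih =>
    simp only [FirstOrder.Language.Term.subst]
    congr 1
    funext i
    refine ih i fun x hx => h x ?_
    simp only [FirstOrder.Language.Term.varFinset, Finset.mem_biUnion, Finset.mem_univ, true_and]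
    exact ⟨i, hx⟩

open Classical in
theorem SubstGraph.functional {L : FirstOrder.Language.{u, v}} {V : Type w} {s t : L.Term V}
    (h : s.varFinset = t.varFinset) (a b c : L.Term V) (hb : SubstGraph s t a b)
    (hc : SubstGraph s t a c) : b = c := by
  obtain ⟨φ, hφ, rfl⟩ := hb
  obtain ⟨ψ, hψ, rfl⟩ := hc
  exact subst_congr_of_varFinset t
    (h ▸ subst_eq_of_varFinset s (hφ.trans hψ.symm))

theorem TranslatedGraph.functional {L : FirstOrder.Language.{u, v}} {V : Type w}
    {R : L.Term V → L.Term V → Prop} (hR : ∀ a b c, R a b → R a c → b = c)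
    (α : TermAddress L) (a b c : L.Term V) (hb : TranslatedGraph R α a b)
    (hc : TranslatedGraph R α a c) : b = c := by
  induction hb generalizing c with
  | root h => cases hc with
    | root h' => exact hR _ _ _ h h'
  | step f i args h ih => cases hc with
    | step _ _ _ h' => rw [ih _ h']

theorem TranslatedGraph.swap {L : FirstOrder.Language.{u, v}} {V : Type w}
    {R S : L.Term V → L.Term V → Prop} (hRS : ∀ a b, R a b → S b a)
    {α : TermAddress L} {a b : L.Term V} (h : TranslatedGraph R α a b) :
    TranslatedGraph S α b a := by
  induction h with
  | root h => exact .root (hRS _ _ h)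
  | step f i args h ih =>
    rename_i b
    have := TranslatedGraph.step f i (Function.update args i b) (b := args i) (α := ‹_›)
      (R := S) (by simpa using ih)
    simpa using this

namespace BalancedTheory

variable {L : FirstOrder.Language.{u, v}} {V : Type w} (T : BalancedTheory L V)

/-- The generators of the structure monoid: the translates of `ρ_{s,t}`, where `(s, t)` or
`(t, s)` is an equation of the theory. -/
def generators : Set (PartialEndo (L.Term V)) :=
  {ρ | ∃ (s t : L.Term V) (α : TermAddress L),
    ((s, t) ∈ T.eqns ∨ (t, s) ∈ T.eqns) ∧ ρ = translatedOp s t α}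

/-- The structure monoid of a balanced equational theory. -/
def Struct : Submonoid (PartialEndo (L.Term V)) := Submonoid.closure T.generators

/-- The congruence on the structure monoid generated by collapsing all idempotents to `1`. -/
def idempotentCon : Con T.Struct := conGen fun a b => IsIdempotentElem a ∧ b = 1

/-- The structure group of a balanced equational theory: the universal group of its structure
monoid, obtained by collapsing all idempotents to `1`. -/
def StructGroup : Type (max u w) := T.idempotentCon.Quotient

instance : Monoid T.StructGroup := inferInstanceAs (Monoid T.idempotentCon.Quotient)

/-- The canonical homomorphism from the structure monoid to the structure group. -/
def toStructGroup : T.Struct →* T.StructGroup := T.idempotentCon.mk'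

theorem toStructGroup_surjective : Function.Surjective T.toStructGroup := Con.mk'_surjective

theorem toStructGroup_idempotent (a : T.Struct) (ha : IsIdempotentElem a) :
    T.toStructGroup a = 1 :=
  T.idempotentCon.eq.2 (ConGen.Rel.of _ _ ⟨ha, rfl⟩)

theorem maps_translatedOp {s t : L.Term V} (h : (s, t) ∈ T.eqns ∨ (t, s) ∈ T.eqns)
    (α : TermAddress L) (a b : L.Term V) :
    (translatedOp s t α).Maps a b ↔ TranslatedGraph (SubstGraph s t) α a b := by
  refine PartialEndo.maps_ofGraph (TranslatedGraph.functional (SubstGraph.functional ?_) α)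
  rcases h with h | h
  · exact T.balanced _ h
  · exact (T.balanced _ h).symm

theorem exists_left_inverse (q : T.StructGroup) : ∃ r, r * q = 1 := by
  obtain ⟨⟨ρ, hρ⟩, rfl⟩ := T.toStructGroup_surjective q
  induction hρ using Submonoid.closure_induction with
  | mem ρ hρ =>
    obtain ⟨s, t, α, hst, rfl⟩ := id hρ
    have hts : translatedOp t s α ∈ T.Struct :=
      Submonoid.subset_closure ⟨t, s, α, hst.symm, rfl⟩
    refine ⟨T.toStructGroup ⟨_, hts⟩, ?_⟩
    rw [← map_mul]
    apply toStructGroup_idempotent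
    have key : ∀ a b, (translatedOp t s α * translatedOp s t α).Maps a b → a = b := by
      intro a b hab
      obtain ⟨c, hac, hcb⟩ := PartialEndo.maps_mul.1 hab
      rw [T.maps_translatedOp hst.symm] at hac
      have hca := (T.maps_translatedOp hst α c a).2
        (hac.swap fun _ _ ⟨φ, h₁, h₂⟩ => ⟨φ, h₂, h₁⟩)
      exact Part.mem_unique hca hcb
    apply Subtype.ext
    apply PartialEndo.ext_maps
    intro a b
    constructor
    · intro h
      obtain ⟨c, hac, hcb⟩ := PartialEndo.maps_mul.1 h
      cases key _ _ hac
      exact hcb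
    · intro h
      have h' := h
      cases key _ _ h
      exact PartialEndo.maps_mul.2 ⟨_, h', h'⟩
  | one => exact ⟨1, by rw [one_mul]; exact T.toStructGroup.map_one⟩
  | mul x y hx hy ihx ihy =>
    obtain ⟨r, hr⟩ := ihx
    obtain ⟨r', hr'⟩ := ihy
    refine ⟨r' * r, ?_⟩
    have : T.toStructGroup ⟨x * y, mul_mem hx hy⟩
        = T.toStructGroup ⟨x, hx⟩ * T.toStructGroup ⟨y, hy⟩ := by
      rw [← map_mul]; rfl
    rw [this, mul_assoc, ← mul_assoc r, hr, one_mul, hr']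

noncomputable instance : Group T.StructGroup where
  inv q := (T.exists_left_inverse q).choose
  inv_mul_cancel q := (T.exists_left_inverse q).choose_spec

end BalancedTheory

end Structure

/-! ### The theory of `n`-catalan algebras -/

/-- Function symbols graded by arity: a single symbol, of arity `n`. -/
inductive TensorSymbol (n : ℕ) : ℕ → Type
  | tensor : TensorSymbol n n

/-- The language with a single function symbol, of arity `n`. -/
def tensorLanguage (n : ℕ) : FirstOrder.Language := ⟨TensorSymbol n, fun _ => Empty⟩

/-- The term `⊗(t₁, …, tₙ)`. -/
def tensor {n : ℕ} {V : Type*} (ts : Fin n → (tensorLanguage n).Term V) :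
    (tensorLanguage n).Term V :=
  FirstOrder.Language.Term.func (l := n) (TensorSymbol.tensor : TensorSymbol n n) ts

/-- For `0 ≤ p < n`, and variables numbered from `0` to `2n - 2`, the term
`⊗(x₀, …, x_{p-1}, ⊗(x_p, …, x_{p+n-1}), x_{p+n}, …, x_{2n-2})`. -/
def nestedTensor {n : ℕ} {V : Type*} (x : Fin (2 * n - 1) → V) (p : Fin n) :
    (tensorLanguage n).Term V :=
  tensor fun j =>
    if j < p then FirstOrder.Language.Term.var (x ⟨j, by omega⟩)
    else if j = p then tensor fun k => FirstOrder.Language.Term.var (x ⟨p + k, by omega⟩)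
    else FirstOrder.Language.Term.var (x ⟨j + n - 1, by omega⟩)

open Classical in
theorem mem_varFinset_nestedTensor {n : ℕ} {V : Type*} (x : Fin (2 * n - 1) → V) (p : Fin n)
    (v : V) : v ∈ (nestedTensor x p).varFinset ↔ ∃ j, x j = v := by
  simp only [nestedTensor, tensor, FirstOrder.Language.Term.varFinset, Finset.mem_biUnion, Finset.mem_univ,
    true_and]
  constructor
  · rintro ⟨j, hj⟩
    split_ifs at hj
    · simp only [FirstOrder.Language.Term.varFinset, Finset.mem_singleton] at hj
      exact ⟨_, hj.symm⟩
    · simp only [FirstOrder.Language.Term.varFinset, Finset.mem_biUnion, Finset.mem_univ, true_and,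
        Finset.mem_singleton] at hj
      obtain ⟨k, hk⟩ := hj
      exact ⟨_, hk.symm⟩
    · simp only [FirstOrder.Language.Term.varFinset, Finset.mem_singleton] at hj
      exact ⟨_, hj.symm⟩
  · rintro ⟨j, rfl⟩
    by_cases h₁ : (j : ℕ) < p
    · refine ⟨⟨j, by omega⟩, ?_⟩
      rw [if_pos (by simpa [Fin.lt_def] using h₁)]
      simp
    · by_cases h₂ : (j : ℕ) < p + n
      · refine ⟨p, ?_⟩
        rw [if_neg (lt_irrefl _), if_pos rfl]
        simp only [FirstOrder.Language.Term.varFinset, Finset.mem_biUnion, Finset.mem_univ, true_and,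
          Finset.mem_singleton]
        exact ⟨⟨j - p, by omega⟩, congrArg x (Fin.ext (by simp; omega))⟩
      · refine ⟨⟨j - (n - 1), by omega⟩, ?_⟩
        rw [if_neg (by simp [Fin.lt_def]; omega), if_neg (by simp [Fin.ext_iff]; omega)]
        simp only [FirstOrder.Language.Term.varFinset, Finset.mem_singleton]
        exact congrArg x (Fin.ext (by simp; omega))

/-- The theory `C_n` of `n`-catalan algebras: for `0 < i < n`, the equation
`⊗(x₁, …, x_i, ⊗(x_{i+1}, …, x_{i+n}), x_{i+n+1}, …, x_{2n-1}) =
⊗(x₁, …, x_{i-1}, ⊗(x_i, …, x_{i+n-1}), x_{i+n}, …, x_{2n-1})`,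
in given distinct variables `x₁, …, x_{2n-1}` (which are `x 0, …, x (2n-2)` here). -/
def catalanTheory (n : ℕ) {V : Type*} (x : Fin (2 * n - 1) ↪ V) :
    BalancedTheory (tensorLanguage n) V where
  eqns := {p | ∃ (i : ℕ) (_ : 0 < i) (hi : i < n),
    p = (nestedTensor x ⟨i, hi⟩, nestedTensor x ⟨i - 1, by omega⟩)}
  balanced := by
    rintro _ ⟨i, h₀, hi, rfl⟩
    ext v
    simp only [mem_varFinset_nestedTensor]

/-! ### Trees and tree diagrams -/

/-- `n`-ary trees. -/
inductive NTree (n : ℕ) : Type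
  | leaf : NTree n
  | node : (Fin n → NTree n) → NTree n

namespace NTree

variable {n : ℕ}

/-- The leaves of a tree, as words in the free monoid on `{1, …, n}`: a leaf is identified with
the path that leads to it from the root. -/
def leafSet : NTree n → Set (List (Fin n))
  | leaf => {[]}
  | node c => {w | ∃ i, ∃ v ∈ (c i).leafSet, w = i :: v}

/-- The type of leaves of a tree; as a subtype of `List (Fin n)`, it is ordered
lexicographically. -/
abbrev Leaf (T : NTree n) : Type := {w : List (Fin n) // w ∈ T.leafSet}

/-- The simple expansion of a tree at the leaf `w`: the leaf is replaced by a vertex with `n`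
leaves attached. (If `w` is not a leaf, the tree is left unchanged.) -/
def expandAt : NTree n → List (Fin n) → NTree n
  | leaf, [] => node fun _ => leaf
  | leaf, _ :: _ => leaf
  | node c, [] => node c
  | node c, i :: w => node (Function.update c i ((c i).expandAt w))

/-- `T'` is an expansion of `T`. -/
def Expands (T T' : NTree n) : Prop :=
  Relation.ReflTransGen (fun A B => ∃ w ∈ A.leafSet, B = A.expandAt w) T T'

theorem nil_mem_leafSet_node {c : Fin n → NTree n} : [] ∉ (node c).leafSet := by
  simp [leafSet]

theorem cons_mem_leafSet_node {c : Fin n → NTree n} {i : Fin n} {w : List (Fin n)} :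
    i :: w ∈ (node c).leafSet ↔ w ∈ (c i).leafSet := by
  simp [leafSet]

theorem eq_of_leafSet_eq {T T' : NTree n} (h : T.leafSet = T'.leafSet) : T = T' := by
  induction T generalizing T' with
  | leaf =>
    cases T' with
    | leaf => rfl
    | node c => exact absurd (Set.ext_iff.1 h [] |>.1 rfl) nil_mem_leafSet_node
  | node c ih =>
    cases T' with
    | leaf => exact absurd (Set.ext_iff.1 h [] |>.2 rfl) nil_mem_leafSet_node
    | node c' =>
      congr 1
      funext i
      apply ih
      ext w
      rw [← cons_mem_leafSet_node, h, cons_mem_leafSet_node]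

theorem mem_leafSet_expandAt {T : NTree n} {l : List (Fin n)} (hl : l ∈ T.leafSet)
    {w : List (Fin n)} :
    w ∈ (T.expandAt l).leafSet ↔ (w ∈ T.leafSet ∧ w ≠ l) ∨ ∃ i, w = l ++ [i] := by
  induction T generalizing l w with
  | leaf =>
    obtain rfl : l = [] := hl
    simp [expandAt, leafSet]
  | node c ih =>
    obtain ⟨i, v, hv, rfl⟩ := hl
    cases w with
    | nil => simp [expandAt, leafSet]
    | cons j w =>
      rw [expandAt, cons_mem_leafSet_node, cons_mem_leafSet_node]
      by_cases hij : j = i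
      · subst hij
        simp [ih _ hv]
      · simp [hij]

theorem eq_nil_of_append_mem {T : NTree n} {u v : List (Fin n)} (hu : u ∈ T.leafSet)
    (huv : u ++ v ∈ T.leafSet) : v = [] := by
  induction T generalizing u with
  | leaf =>
    obtain rfl : u = [] := hu
    exact huv
  | node c ih =>
    obtain ⟨i, u, hu, rfl⟩ := hu
    exact ih i hu (cons_mem_leafSet_node.1 huv)

theorem append_inj_of_mem {T : NTree n} {k k' w w' : List (Fin n)} (hk : k ∈ T.leafSet)
    (hk' : k' ∈ T.leafSet) (h : k ++ w = k' ++ w') : k = k' ∧ w = w' := by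
  have : k = k' := by
    rcases List.append_eq_append_iff.1 h with ⟨a, rfl, -⟩ | ⟨a, rfl, -⟩
    · simp [eq_nil_of_append_mem hk hk']
    · simp [eq_nil_of_append_mem hk' hk]
  subst this
  exact ⟨rfl, List.append_cancel_left h⟩

theorem Expands.child {c : Fin n → NTree n} (i : Fin n) {d : NTree n} (h : Expands (c i) d) :
    Expands (node c) (node (Function.update c i d)) := by
  induction h with
  | refl => rw [Function.update_eq_self]; exact .refl
  | tail _ hbc ih =>
    obtain ⟨w, hw, rfl⟩ := hbc
    refine ih.tail ⟨i :: w, ?_, ?_⟩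
    · simpa [cons_mem_leafSet_node] using hw
    · simp [expandAt]

theorem Expands.children {c c' : Fin n → NTree n} (h : ∀ i, Expands (c i) (c' i)) :
    Expands (node c) (node c') := by
  have key : ∀ s : Finset (Fin n),
      Expands (node c) (node fun i => if i ∈ s then c' i else c i) := by
    intro s
    induction s using Finset.induction_on with
    | empty => simp only [Finset.notMem_empty, if_false]; exact .refl
    | insert a s ha ih =>
      have he : (fun i => if i ∈ insert a s then c' i else c i) =
          Function.update (fun i => if i ∈ s then c' i else c i) a (c' a) := by
        funext i
        by_cases hi : i = a
        · subst hi; simp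
        · simp [hi]
      rw [he]
      exact ih.trans (Expands.child (c := fun i => if i ∈ s then c' i else c i) a (d := c' a)
        (by simpa [ha] using h a))
  simpa using key Finset.univ

theorem leaf_expands (T : NTree n) : Expands leaf T := by
  induction T with
  | leaf => exact .refl
  | node c ih =>
    exact .trans (.single ⟨[], rfl, by simp [expandAt]⟩) (Expands.children ih)

theorem exists_common_expansion (T T' : NTree n) : ∃ S, Expands T S ∧ Expands T' S := by
  induction T generalizing T' with
  | leaf => exact ⟨T', leaf_expands T', .refl⟩
  | node c ih =>
    cases T' with
    | leaf => exact ⟨_, .refl, leaf_expands _⟩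
    | node c' =>
      choose d hd hd' using fun i => ih i (c' i)
      exact ⟨node d, Expands.children hd, Expands.children hd'⟩

end NTree

/-- `n`-ary tree diagrams: two trees and a bijection between their sets of leaves. -/
structure TreeDiagram (n : ℕ) where
  src : NTree n
  tgt : NTree n
  σ : src.Leaf ≃ tgt.Leaf

namespace TreeDiagram

variable {n : ℕ}

/-- `D'` is the simple expansion of `D = (T₁, T₂, σ)` along a leaf `l` of `T₁`. The leaf
`α_i(l)` that is attached to `l` is the word `l ++ [i]`. -/
def IsSimpleExpansion (D D' : TreeDiagram n) : Prop :=
  ∃ l : D.src.Leaf, D'.src = D.src.expandAt l ∧ D'.tgt = D.tgt.expandAt (D.σ l) ∧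
    (∀ (k : D.src.Leaf) (k' : D'.src.Leaf), k ≠ l → k'.1 = k.1 → (D'.σ k').1 = (D.σ k).1) ∧
    (∀ (i : Fin n) (k' : D'.src.Leaf), k'.1 = l.1 ++ [i] → (D'.σ k').1 = (D.σ l).1 ++ [i])

/-- `D'` is an expansion of `D`: it is obtained by finitely many successive simple expansions. -/
def Expands (D D' : TreeDiagram n) : Prop := Relation.ReflTransGen IsSimpleExpansion D D'

theorem ext_of_src {D D' : TreeDiagram n} (h : D.src = D'.src)
    (hσ : ∀ (k : D.src.Leaf) (k' : D'.src.Leaf), k.1 = k'.1 → (D.σ k).1 = (D'.σ k').1) :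
    D = D' := by
  obtain ⟨S, T, σ⟩ := D
  obtain ⟨S', T', σ'⟩ := D'
  dsimp only at h
  subst h
  have : T = T' := by
    apply NTree.eq_of_leafSet_eq
    ext w
    constructor
    · intro hw
      have := hσ (σ.symm ⟨w, hw⟩) (σ.symm ⟨w, hw⟩) rfl
      dsimp only at this
      rw [Equiv.apply_symm_apply] at this
      exact Set.mem_of_eq_of_mem this (σ' _).2
    · intro hw
      have := hσ (σ'.symm ⟨w, hw⟩) (σ'.symm ⟨w, hw⟩) rfl
      dsimp only at this
      rw [Equiv.apply_symm_apply] at this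
      exact Set.mem_of_eq_of_mem this.symm (σ _).2
  subst this
  congr 1
  ext k : 2
  exact hσ k k rfl

theorem Expands.src_expands {D D' : TreeDiagram n} (h : D.Expands D') : D.src.Expands D'.src := by
  induction h with
  | refl => exact .refl
  | tail _ h ih =>
    obtain ⟨l, h₁, -⟩ := h
    exact ih.tail ⟨l, l.2, h₁⟩

theorem Expands.tgt_expands {D D' : TreeDiagram n} (h : D.Expands D') : D.tgt.Expands D'.tgt := by
  induction h with
  | refl => exact .refl
  | tail _ h ih =>
    obtain ⟨l, -, h₂, -⟩ := h
    exact ih.tail ⟨_, Subtype.property _, h₂⟩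

theorem Expands.exists_prefix {D D' : TreeDiagram n} (h : D.Expands D') (k' : D'.src.Leaf) :
    ∃ (k : D.src.Leaf) (w : List (Fin n)), k'.1 = k.1 ++ w ∧ (D'.σ k').1 = (D.σ k).1 ++ w := by
  induction h with
  | refl => exact ⟨k', [], by simp, by simp⟩
  | @tail B C _ h ih =>
    obtain ⟨l, h₁, h₂, h₃, h₄⟩ := h
    have hk' := (NTree.mem_leafSet_expandAt l.2).1
      ((Set.ext_iff.1 (congrArg NTree.leafSet h₁) k'.1).1 k'.2)
    rcases hk' with ⟨hk, hne⟩ | ⟨i, hi⟩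
    · obtain ⟨k, w, e₁, e₂⟩ := ih ⟨k', hk⟩
      exact ⟨k, w, e₁, (h₃ ⟨k', hk⟩ k' (fun e => hne (congrArg Subtype.val e)) rfl).trans e₂⟩
    · obtain ⟨k, w, e₁, e₂⟩ := ih l
      exact ⟨k, w ++ [i], by rw [hi, e₁, List.append_assoc],
        by rw [h₄ i k' hi, e₂, List.append_assoc]⟩

theorem Expands.unique {D D₁ D₂ : TreeDiagram n} (h₁ : D.Expands D₁) (h₂ : D.Expands D₂)
    (h : D₁.src = D₂.src) : D₁ = D₂ := by
  refine ext_of_src h fun k k' hk => ?_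
  obtain ⟨a, w, e₁, e₂⟩ := h₁.exists_prefix k
  obtain ⟨a', w', e₁', e₂'⟩ := h₂.exists_prefix k'
  obtain ⟨ha, rfl⟩ := NTree.append_inj_of_mem a.2 a'.2 (by rw [← e₁, ← e₁', hk])
  rw [e₂, e₂', Subtype.ext ha]

theorem exists_isSimpleExpansion (D : TreeDiagram n) (l : D.src.Leaf) :
    ∃ D', D.IsSimpleExpansion D' ∧ D'.src = D.src.expandAt l := by
  classical
  let f : (D.src.expandAt l).Leaf → List (Fin n) := fun w =>
    if h : w.1 ∈ D.src.leafSet then (D.σ ⟨w.1, h⟩).1 else (D.σ l).1 ++ w.1.drop l.1.length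
  have hnot : ∀ i, l.1 ++ [i] ∉ D.src.leafSet := fun i hi => by
    simpa using NTree.eq_nil_of_append_mem l.2 hi
  have hnot' : ∀ i, (D.σ l).1 ++ [i] ∉ D.tgt.leafSet := fun i hi => by
    simpa using NTree.eq_nil_of_append_mem (D.σ l).2 hi
  have f₁ : ∀ (k : D.src.Leaf) (k' : (D.src.expandAt l).Leaf), k'.1 = k.1 →
      f k' = (D.σ k).1 := by
    rintro ⟨k, hk⟩ ⟨k', hk'⟩ (rfl : k' = k)
    simp [f, hk]
  have f₂ : ∀ (i : Fin n) (k' : (D.src.expandAt l).Leaf), k'.1 = l.1 ++ [i] →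
      f k' = (D.σ l).1 ++ [i] := by
    rintro i ⟨_, hk'⟩ rfl
    simp [f, hnot i]
  have hcase : ∀ k' : (D.src.expandAt l).Leaf,
      (∃ k : D.src.Leaf, k ≠ l ∧ k'.1 = k.1 ∧ f k' = (D.σ k).1) ∨
      ∃ i, k'.1 = l.1 ++ [i] ∧ f k' = (D.σ l).1 ++ [i] := by
    intro k'
    rcases (NTree.mem_leafSet_expandAt l.2).1 k'.2 with ⟨h, hne⟩ | ⟨i, hi⟩
    · exact .inl ⟨⟨k', h⟩, fun e => hne (congrArg Subtype.val e), rfl, f₁ ⟨k', h⟩ k' rfl⟩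
    · exact .inr ⟨i, hi, f₂ i k' hi⟩
  have hf : ∀ k', f k' ∈ (D.tgt.expandAt (D.σ l)).leafSet := by
    intro k'
    rw [NTree.mem_leafSet_expandAt (D.σ l).2]
    rcases hcase k' with ⟨k, hne, -, e⟩ | ⟨i, -, e⟩
    · refine .inl ⟨e ▸ (D.σ k).2, fun h => hne ?_⟩
      exact D.σ.injective (Subtype.ext (e.symm.trans h))
    · exact .inr ⟨i, e⟩
  let g : (D.src.expandAt l).Leaf → (D.tgt.expandAt (D.σ l)).Leaf := fun k' => ⟨f k', hf k'⟩
  have hg : Function.Bijective g := by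
    constructor
    · intro a b hab
      have hab : f a = f b := congrArg Subtype.val hab
      apply Subtype.ext
      rcases hcase a with ⟨k, -, e₁, e₂⟩ | ⟨i, e₁, e₂⟩ <;>
        rcases hcase b with ⟨k', -, e₁', e₂'⟩ | ⟨i', e₁', e₂'⟩ <;> rw [e₂, e₂'] at hab
      · rw [e₁, e₁', D.σ.injective (Subtype.ext hab)]
      · exact absurd (hab ▸ (D.σ k).2) (hnot' i')
      · exact absurd (hab ▸ (D.σ k').2) (hnot' i)
      · rw [e₁, e₁', (NTree.append_inj_of_mem (D.σ l).2 (D.σ l).2 hab).2]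
    · rintro ⟨v, hv⟩
      rcases (NTree.mem_leafSet_expandAt (D.σ l).2).1 hv with ⟨h, hne⟩ | ⟨i, rfl⟩
      · have hne' : (D.σ.symm ⟨v, h⟩).1 ≠ l.1 := fun e => hne (by
          rw [← Subtype.ext e]; simp)
        refine ⟨⟨(D.σ.symm ⟨v, h⟩).1, (NTree.mem_leafSet_expandAt l.2).2
          (.inl ⟨(D.σ.symm ⟨v, h⟩).2, hne'⟩)⟩, Subtype.ext ?_⟩
        exact (f₁ (D.σ.symm ⟨v, h⟩) _ rfl).trans (by simp)
      · exact ⟨⟨l.1 ++ [i], (NTree.mem_leafSet_expandAt l.2).2 (.inr ⟨i, rfl⟩)⟩,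
          Subtype.ext (f₂ i _ rfl)⟩
  exact ⟨⟨_, _, Equiv.ofBijective g hg⟩, ⟨l, rfl, rfl, fun k k' _ h => f₁ k k' h, f₂⟩, rfl⟩

theorem exists_expands_src (D : TreeDiagram n) {S : NTree n} (h : D.src.Expands S) :
    ∃ D', D.Expands D' ∧ D'.src = S := by
  induction h with
  | refl => exact ⟨D, .refl, rfl⟩
  | tail _ h ih =>
    obtain ⟨w, hw, rfl⟩ := h
    obtain ⟨E, hE, rfl⟩ := ih
    obtain ⟨D', h₁, h₂⟩ := E.exists_isSimpleExpansion ⟨w, hw⟩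
    exact ⟨D', hE.tail h₁, h₂⟩

/-- The diagram `(T₂, T₁, σ⁻¹)`. -/
def symm (D : TreeDiagram n) : TreeDiagram n := ⟨D.tgt, D.src, D.σ.symm⟩

theorem IsSimpleExpansion.symm {D D' : TreeDiagram n} (h : D.IsSimpleExpansion D') :
    D.symm.IsSimpleExpansion D'.symm := by
  obtain ⟨l, h₁, h₂, h₃, h₄⟩ := h
  refine ⟨D.σ l, h₂, ?_, ?_, ?_⟩
  · exact h₁.trans (congrArg (fun a : D.src.Leaf => D.src.expandAt a)
      (D.σ.symm_apply_apply l).symm)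
  · intro (k : D.tgt.Leaf) (k' : D'.tgt.Leaf) hne e
    change (D'.σ.symm k').1 = (D.σ.symm k).1
    have hne' : D.σ.symm k ≠ l := fun e => hne (by rw [← e, Equiv.apply_symm_apply])
    have hm : (D.σ.symm k).1 ∈ D'.src.leafSet := by
      rw [h₁, NTree.mem_leafSet_expandAt l.2]
      exact .inl ⟨(D.σ.symm k).2, fun e => hne' (Subtype.ext e)⟩
    have := h₃ (D.σ.symm k) ⟨_, hm⟩ hne' rfl
    rw [Equiv.apply_symm_apply, ← e] at this
    rw [← Subtype.ext this, Equiv.symm_apply_apply]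
  · intro i (k' : D'.tgt.Leaf) e
    change (D'.σ.symm k').1 = (D.σ.symm (D.σ l)).1 ++ [i]
    have hm : l.1 ++ [i] ∈ D'.src.leafSet := by
      rw [h₁, NTree.mem_leafSet_expandAt l.2]
      exact .inr ⟨i, rfl⟩
    have := h₄ i ⟨_, hm⟩ rfl
    rw [← e] at this
    rw [← Subtype.ext this, Equiv.symm_apply_apply, Equiv.symm_apply_apply]

theorem Expands.symm {D D' : TreeDiagram n} (h : D.Expands D') : D.symm.Expands D'.symm := by
  induction h with
  | refl => exact .refl
  | tail _ h ih => exact ih.tail h.symm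

theorem exists_expands_tgt (D : TreeDiagram n) {S : NTree n} (h : D.tgt.Expands S) :
    ∃ D', D.Expands D' ∧ D'.tgt = S := by
  obtain ⟨E, h₁, h₂⟩ := D.symm.exists_expands_src h
  exact ⟨E.symm, h₁.symm, h₂⟩

/-- Two diagrams are equivalent when they have a common expansion. -/
instance setoid (n : ℕ) : Setoid (TreeDiagram n) where
  r D D' := ∃ E, D.Expands E ∧ D'.Expands E
  iseqv := by
    refine ⟨fun D => ⟨D, .refl, .refl⟩, fun ⟨E, h, h'⟩ => ⟨E, h', h⟩, ?_⟩
    rintro D₁ D₂ D₃ ⟨E, h₁, h₂⟩ ⟨F, h₂', h₃⟩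
    obtain ⟨S, hE, hF⟩ := NTree.exists_common_expansion E.src F.src
    obtain ⟨E', hE', rfl⟩ := E.exists_expands_src hE
    obtain ⟨F', hF', h⟩ := F.exists_expands_src hF
    obtain rfl := Expands.unique (h₂.trans hE') (h₂'.trans hF') h.symm
    exact ⟨_, h₁.trans hE', h₃.trans hF'⟩

theorem Expands.comp {A A' B B' C C' : NTree n} {σ : A.Leaf ≃ B.Leaf} {τ : B.Leaf ≃ C.Leaf}
    {σ' : A'.Leaf ≃ B'.Leaf} {τ' : B'.Leaf ≃ C'.Leaf} (h₁ : Expands ⟨A, B, σ⟩ ⟨A', B', σ'⟩)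
    (h₂ : Expands ⟨B, C, τ⟩ ⟨B', C', τ'⟩) :
    Expands ⟨A, C, σ.trans τ⟩ ⟨A', C', σ'.trans τ'⟩ := by
  obtain ⟨X, hX, hs⟩ := exists_expands_src ⟨A, C, σ.trans τ⟩ h₁.src_expands
  suffices X = ⟨A', C', σ'.trans τ'⟩ from this ▸ hX
  refine ext_of_src hs fun k k' hk => ?_
  obtain ⟨a, w, e₁, e₂⟩ := hX.exists_prefix k
  obtain ⟨a', w', e₁', e₂'⟩ := h₁.exists_prefix k'
  obtain ⟨b, v, e₁'', e₂''⟩ := h₂.exists_prefix (σ' k')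
  dsimp only at a a' b k' e₁ e₂ e₁' e₂' e₁'' e₂'' ⊢
  obtain ⟨ha, rfl⟩ := NTree.append_inj_of_mem a.2 a'.2 (by rw [← e₁, ← e₁', hk])
  obtain rfl := Subtype.ext ha
  obtain ⟨hb, rfl⟩ := NTree.append_inj_of_mem b.2 (σ a).2 (by rw [← e₁'', ← e₂'])
  obtain rfl := Subtype.ext hb
  rw [e₂, Equiv.trans_apply, Equiv.trans_apply, e₂'']

/-- A diagram is order-preserving if its bijection preserves the lexicographic order. -/
def OrderPreserving (D : TreeDiagram n) : Prop := StrictMono D.σ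

theorem _root_.List.append_lt_append_of_not_prefix {α : Type*} [LinearOrder α] {u v : List α}
    (h : u < v) (huv : ¬ u <+: v) (a b : List α) : u ++ a < v ++ b := by
  induction h with
  | nil => exact absurd (List.nil_prefix) huv
  | rel h => exact List.Lex.rel h
  | cons _ ih => exact List.Lex.cons (ih fun h => huv (by simpa using h))

theorem _root_.NTree.not_prefix {T : NTree n} {k k' : T.Leaf} (h : k ≠ k') :
    ¬ k.1 <+: k'.1 := by
  rintro ⟨w, hw⟩
  exact h (Subtype.ext (NTree.append_inj_of_mem k.2 k'.2 (hw.trans (List.append_nil _).symm)).1)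

theorem Expands.orderPreserving {D D' : TreeDiagram n} (h : D.Expands D')
    (hD : D.OrderPreserving) : D'.OrderPreserving := by
  intro a b hab
  obtain ⟨k, w, e₁, e₂⟩ := h.exists_prefix a
  obtain ⟨k', w', e₁', e₂'⟩ := h.exists_prefix b
  rw [← Subtype.coe_lt_coe, e₁, e₁'] at hab
  rw [← Subtype.coe_lt_coe, e₂, e₂']
  rcases lt_trichotomy k k' with hk | rfl | hk
  · exact List.append_lt_append_of_not_prefix (hD hk)
      (NTree.not_prefix (hD hk).ne) _ _
  · have hw : w < w' := by
      rcases lt_trichotomy w w' with hw | rfl | hw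
      · exact hw
      · exact absurd hab (lt_irrefl _)
      · exact absurd (hab.trans (List.Lex.append_left _ hw _)) (lt_irrefl _)
    exact List.Lex.append_left _ hw _
  · exact absurd (hab.trans (List.append_lt_append_of_not_prefix hk
      (NTree.not_prefix hk.ne) _ _)) (lt_irrefl _)

end TreeDiagram

/-! ### The groups `G_{n,1}` and `F_{n,1}` -/

/-- The set of `n`-ary tree symbols, which underlies the group `G_{n,1}`. -/
def HigmanThompson (n : ℕ) : Type := Quotient (TreeDiagram.setoid n)

namespace HigmanThompson

variable {n : ℕ}

/-- The tree symbol `[(T₁, T₂, σ)]`. -/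
def symbol (T₁ T₂ : NTree n) (σ : T₁.Leaf ≃ T₂.Leaf) : HigmanThompson n :=
  Quotient.mk (TreeDiagram.setoid n) ⟨T₁, T₂, σ⟩

theorem exists_symbol (q : HigmanThompson n) :
    ∃ (T₁ T₂ : NTree n) (σ : T₁.Leaf ≃ T₂.Leaf), q = symbol T₁ T₂ σ := by
  obtain ⟨⟨T₁, T₂, σ⟩, rfl⟩ := Quotient.exists_rep q
  exact ⟨T₁, T₂, σ, rfl⟩

theorem symbol_eq_of_expands {D D' : TreeDiagram n} (h : D.Expands D') :
    symbol D.src D.tgt D.σ = symbol D'.src D'.tgt D'.σ :=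
  Quotient.sound ⟨D', h, .refl⟩

theorem exists_symbol_src (q : HigmanThompson n) : ∃ T : NTree n, ∀ S, T.Expands S →
    ∃ (T₂ : NTree n) (σ : S.Leaf ≃ T₂.Leaf), q = symbol S T₂ σ := by
  obtain ⟨T₁, T₂, σ, rfl⟩ := q.exists_symbol
  refine ⟨T₁, fun S hS => ?_⟩
  obtain ⟨D, hD, rfl⟩ := TreeDiagram.exists_expands_src ⟨T₁, T₂, σ⟩ hS
  exact ⟨_, _, symbol_eq_of_expands hD⟩

theorem exists_symbol_tgt (q : HigmanThompson n) : ∃ T : NTree n, ∀ S, T.Expands S →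
    ∃ (T₁ : NTree n) (σ : T₁.Leaf ≃ S.Leaf), q = symbol T₁ S σ := by
  obtain ⟨T₁, T₂, σ, rfl⟩ := q.exists_symbol
  refine ⟨T₂, fun S hS => ?_⟩
  obtain ⟨D, hD, rfl⟩ := TreeDiagram.exists_expands_tgt ⟨T₁, T₂, σ⟩ hS
  exact ⟨_, _, symbol_eq_of_expands hD⟩

/-- `q` is the product of `q₁` and `q₂`: there are representatives `(T₁, T, σ)` of `q₁` and
`(T, T₂, τ)` of `q₂`, and `q` is the class of `(T₁, T₂, σ · τ)`, where `σ · τ` is `σ` followed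
by `τ`. -/
def IsProduct (q₁ q₂ q : HigmanThompson n) : Prop :=
  ∃ (T₁ T T₂ : NTree n) (σ : T₁.Leaf ≃ T.Leaf) (τ : T.Leaf ≃ T₂.Leaf),
    q₁ = symbol T₁ T σ ∧ q₂ = symbol T T₂ τ ∧ q = symbol T₁ T₂ (σ.trans τ)

theorem exists_isProduct (q₁ q₂ : HigmanThompson n) : ∃ q, IsProduct q₁ q₂ q := by
  obtain ⟨T, hT⟩ := q₁.exists_symbol_tgt
  obtain ⟨T', hT'⟩ := q₂.exists_symbol_src
  obtain ⟨S, hS, hS'⟩ := NTree.exists_common_expansion T T'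
  obtain ⟨T₁, σ, h₁⟩ := hT S hS
  obtain ⟨T₂, τ, h₂⟩ := hT' S hS'
  exact ⟨_, T₁, S, T₂, σ, τ, h₁, h₂, rfl⟩

theorem IsProduct.unique {q₁ q₂ q q' : HigmanThompson n} (h : IsProduct q₁ q₂ q)
    (h' : IsProduct q₁ q₂ q') : q = q' := by
  obtain ⟨A, B, C, σ, τ, rfl, rfl, rfl⟩ := h
  obtain ⟨A', B', C', σ', τ', h₁, h₂, rfl⟩ := h'
  obtain ⟨E, hE, hE'⟩ := Quotient.exact h₁
  obtain ⟨F, hF, hF'⟩ := Quotient.exact h₂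
  obtain ⟨S, hES, hFS⟩ := NTree.exists_common_expansion E.tgt F.src
  obtain ⟨⟨X, _, s⟩, hX, rfl⟩ := E.exists_expands_tgt hES
  obtain ⟨⟨_, Y, t⟩, hY, hXY⟩ := F.exists_expands_src hFS
  dsimp only at hXY
  subst hXY
  exact Quotient.sound ⟨⟨X, Y, s.trans t⟩, TreeDiagram.Expands.comp (hE.trans hX) (hF.trans hY),
    TreeDiagram.Expands.comp (hE'.trans hX) (hF'.trans hY)⟩

noncomputable instance : Mul (HigmanThompson n) := ⟨fun q₁ q₂ => (exists_isProduct q₁ q₂).choose⟩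

/-- The defining property of the product. -/
theorem symbol_mul_symbol {T₁ T T₂ : NTree n} (σ : T₁.Leaf ≃ T.Leaf) (τ : T.Leaf ≃ T₂.Leaf) :
    symbol T₁ T σ * symbol T T₂ τ = symbol T₁ T₂ (σ.trans τ) :=
  IsProduct.unique (exists_isProduct _ _).choose_spec ⟨_, _, _, σ, τ, rfl, rfl, rfl⟩

/-- The unit element is `[(T, T, id)]`, for any tree `T`. -/
instance : One (HigmanThompson n) := ⟨symbol .leaf .leaf (Equiv.refl _)⟩

theorem symbol_refl (T : NTree n) : symbol T T (Equiv.refl _) = 1 := by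
  obtain ⟨⟨S, T', σ⟩, hD, rfl⟩ := TreeDiagram.exists_expands_src
    ⟨.leaf, .leaf, Equiv.refl _⟩ (NTree.leaf_expands T)
  have : TreeDiagram.mk S S (Equiv.refl _) = ⟨S, T', σ⟩ := by
    refine TreeDiagram.ext_of_src rfl fun k k' hk => ?_
    obtain ⟨a, w, e₁, e₂⟩ := hD.exists_prefix k'
    exact hk.trans (e₁.trans e₂.symm)
  exact (congrArg (fun D => symbol D.src D.tgt D.σ) this).trans (symbol_eq_of_expands hD).symm

/-- The inverse of `[(T₁, T₂, σ)]` is `[(T₂, T₁, σ⁻¹)]`. -/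
instance : Inv (HigmanThompson n) :=
  ⟨Quotient.map TreeDiagram.symm fun _ _ ⟨E, h, h'⟩ => ⟨E.symm, h.symm, h'.symm⟩⟩

theorem symbol_inv {T₁ T₂ : NTree n} (σ : T₁.Leaf ≃ T₂.Leaf) :
    (symbol T₁ T₂ σ)⁻¹ = symbol T₂ T₁ σ.symm := rfl

/-- The group `G_{n,1}`. -/
noncomputable instance : Group (HigmanThompson n) :=
  Group.ofLeftAxioms
    (by
      intro a b c
      obtain ⟨A, hA⟩ := a.exists_symbol_tgt
      obtain ⟨C, hC⟩ := c.exists_symbol_src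
      obtain ⟨B, B', β, rfl⟩ := b.exists_symbol
      obtain ⟨S, hS, hS'⟩ := NTree.exists_common_expansion A B
      obtain ⟨D, hD, rfl⟩ := TreeDiagram.exists_expands_src ⟨B, B', β⟩ hS'
      obtain ⟨S', h, h'⟩ := NTree.exists_common_expansion D.tgt C
      obtain ⟨E, hE, rfl⟩ := TreeDiagram.exists_expands_tgt D h
      obtain ⟨T₁, σ, rfl⟩ := hA E.src (hS.trans hE.src_expands)
      obtain ⟨T₂, τ, rfl⟩ := hC E.tgt h'
      rw [symbol_eq_of_expands (hD.trans hE)]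
      simp only [symbol_mul_symbol, Equiv.trans_assoc])
    (by
      intro a
      obtain ⟨A, B, σ, rfl⟩ := a.exists_symbol
      rw [← symbol_refl A, symbol_mul_symbol, Equiv.refl_trans])
    (by
      intro a
      obtain ⟨A, B, σ, rfl⟩ := a.exists_symbol
      rw [symbol_inv, symbol_mul_symbol, Equiv.symm_trans_self, symbol_refl])

end HigmanThompson

/-- The group `F_{n,1}`: the subgroup of `G_{n,1}` of the order-preserving tree symbols. -/
def BrownThompson (n : ℕ) : Subgroup (HigmanThompson n) where
  carrier := {q | ∃ (T₁ T₂ : NTree n) (σ : T₁.Leaf ≃ T₂.Leaf),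
    StrictMono σ ∧ q = HigmanThompson.symbol T₁ T₂ σ}
  one_mem' := ⟨.leaf, .leaf, Equiv.refl _, strictMono_id, rfl⟩
  inv_mem' := by
    rintro _ ⟨A, B, σ, hσ, rfl⟩
    refine ⟨B, A, σ.symm, fun a b hab => ?_, rfl⟩
    rw [← hσ.lt_iff_lt]
    simpa using hab
  mul_mem' := by
    rintro _ _ ⟨A, B, σ, hσ, rfl⟩ ⟨B', C, τ, hτ, rfl⟩
    obtain ⟨S, h, h'⟩ := NTree.exists_common_expansion B B'
    obtain ⟨⟨A', _, s⟩, hD, rfl⟩ := TreeDiagram.exists_expands_tgt ⟨A, B, σ⟩ h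
    obtain ⟨⟨_, C', t⟩, hE, e⟩ := TreeDiagram.exists_expands_src ⟨B', C, τ⟩ h'
    dsimp only at e
    subst e
    refine ⟨A', C', s.trans t, (hE.orderPreserving hτ).comp (hD.orderPreserving hσ), ?_⟩
    rw [HigmanThompson.symbol_eq_of_expands hD, HigmanThompson.symbol_eq_of_expands hE,
      HigmanThompson.symbol_mul_symbol]

/-- The tree `T(t)` of a term `t`: forget the labels of the leaves of its term tree. -/
def termTree {n : ℕ} {V : Type*} : (tensorLanguage n).Term V → NTree n
  | .var _ => .leaf
  | @FirstOrder.Language.Term.func _ _ _ TensorSymbol.tensor ts => .node fun i => termTree (ts i)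

/-!
An order-preserving tree diagram `(T₁, T₂, σ)` acts on terms: it maps a term `a` whose term tree
extends `T₁` to the term obtained by planting the subterm of `a` at each leaf `l` of `T₁` at the
leaf `σ l` of `T₂` (`TreeDiagram.Graph`). Labelling the leaves of `T₁` and `T₂` with distinct
variables that match under `σ` shows that such an operator has a seed, and that the trees of a
seed are always `T₁` and `T₂` (`TreeDiagram.termTree_of_substGraph_iff`). As an order-preserving
bijection of finite chains is unique, the operator determines the diagram
(`TreeDiagram.Represents.unique`).

All elements of the structure monoid are such operators (`exists_represents`): in each equation
of `C_n` the variables occur once on either side, in the same order, and operators of this kind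
are closed under translation and composition. For the composition, let `S` be the least common
expansion of the target tree of the first diagram and the source tree of the second. Expanding a
diagram only restricts its operator, and a term in the range of the first operator and in the
domain of the second has a tree that extends `S`; so both diagrams may be expanded until they
meet in `S`, and the product of operators corresponds to the product of tree symbols. This gives
a homomorphism from the structure monoid to `F_{n,1}`, which kills idempotents since the target
is a group.

It is injective on the structure group, because a diagram with trivial symbol moves no leaf, so
that its operator is a restriction of the identity and hence idempotent
(`TreeDiagram.Represents.isIdempotentElem`). It is surjective, because any two trees with the
same number of leaves have the same number of inner vertices and are connected by rotations,
that is, by applications of the equations: every tree can be turned into a right comb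
(`treeConnected_comb`).
-/

/-! ### Subterms and grafting -/

section Subterms

variable {n : ℕ} {V : Type*}

theorem tensor_injective : Function.Injective (tensor (n := n) (V := V)) := by
  intro a b h
  exact eq_of_heq (FirstOrder.Language.Term.func.inj h).2.2

theorem tensor_induction {P : (tensorLanguage n).Term V → Prop}
    (var : ∀ y, P (FirstOrder.Language.Term.var y))
    (tensor : ∀ ts : Fin n → (tensorLanguage n).Term V, (∀ i, P (ts i)) → P (tensor ts))
    (a : (tensorLanguage n).Term V) : P a := by
  induction a with
  | var y => exact var y
  | @func l f ts ih =>
    change TensorSymbol n l at f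
    cases f
    exact tensor ts ih

/-- The subterm of a term at a given path from the root, if the path stays inside the term. -/
def subtermAt : List (Fin n) → (tensorLanguage n).Term V → Option ((tensorLanguage n).Term V)
  | [], a => some a
  | _ :: _, .var _ => none
  | i :: w, @FirstOrder.Language.Term.func _ _ _ TensorSymbol.tensor ts => subtermAt w (ts i)

@[simp] theorem subtermAt_nil (a : (tensorLanguage n).Term V) : subtermAt [] a = some a := by
  simp [subtermAt]

@[simp] theorem subtermAt_cons_var (i : Fin n) (w : List (Fin n)) (y : V) :
    subtermAt (i :: w) (FirstOrder.Language.Term.var y) = none := rfl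

@[simp] theorem subtermAt_cons_tensor (i : Fin n) (w : List (Fin n))
    (ts : Fin n → (tensorLanguage n).Term V) :
    subtermAt (i :: w) (tensor ts) = subtermAt w (ts i) := rfl

@[simp] theorem termTree_var (y : V) :
    termTree (FirstOrder.Language.Term.var y : (tensorLanguage n).Term V) = .leaf := rfl

@[simp] theorem termTree_tensor (ts : Fin n → (tensorLanguage n).Term V) :
    termTree (tensor ts) = .node fun i => termTree (ts i) := rfl

theorem subst_tensor (ts : Fin n → (tensorLanguage n).Term V)
    (φ : V → (tensorLanguage n).Term V) :
    (tensor ts).subst φ = tensor fun i => (ts i).subst φ := rfl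

theorem subst_var (a : (tensorLanguage n).Term V) :
    a.subst FirstOrder.Language.Term.var = a := by
  induction a using tensor_induction with
  | var y => rfl
  | tensor ts ih => simp [subst_tensor, ih]

theorem exists_tensor_of_subtermAt_cons {i : Fin n} {w : List (Fin n)}
    {a c : (tensorLanguage n).Term V} (h : subtermAt (i :: w) a = some c) :
    ∃ ts, a = tensor ts := by
  induction a using tensor_induction with
  | var y => simp at h
  | tensor ts _ => exact ⟨ts, rfl⟩

theorem subtermAt_append (u v : List (Fin n)) (a : (tensorLanguage n).Term V) :
    subtermAt (u ++ v) a = (subtermAt u a).bind (subtermAt v) := by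
  induction u generalizing a with
  | nil => simp
  | cons i u ih =>
    induction a using tensor_induction with
    | var y => simp
    | tensor ts _ => simp [ih]

theorem subtermAt_subst {w : List (Fin n)} {a c : (tensorLanguage n).Term V}
    (h : subtermAt w a = some c) (φ : V → (tensorLanguage n).Term V) :
    subtermAt w (a.subst φ) = some (c.subst φ) := by
  induction w generalizing a with
  | nil => simpa using congrArg (Option.map fun t => t.subst φ) h
  | cons i w ih =>
    obtain ⟨ts, rfl⟩ := exists_tensor_of_subtermAt_cons h
    exact ih (a := ts i) (by simpa using h)

/-- The leaves of `T(a)` are the paths to the variables of `a`. -/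
theorem mem_leafSet_termTree {w : List (Fin n)} {a : (tensorLanguage n).Term V} :
    w ∈ (termTree a).leafSet ↔ ∃ y, subtermAt w a = some (FirstOrder.Language.Term.var y) := by
  induction a using tensor_induction generalizing w with
  | var y => cases w <;> simp [NTree.leafSet]
  | tensor ts ih =>
    cases w with
    | nil => exact iff_of_false NTree.nil_mem_leafSet_node (by simp [tensor])
    | cons i w => simp [NTree.cons_mem_leafSet_node, ih]

/-- A term covers a tree if the tree is an initial part of its term tree: all paths to the leaves
of the tree lead to subterms. -/
def Covers (T : NTree n) (a : (tensorLanguage n).Term V) : Prop :=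
  ∀ w ∈ T.leafSet, ∃ c, subtermAt w a = some c

theorem NTree.leafSet_nonempty [NeZero n] (T : NTree n) : T.leafSet.Nonempty := by
  induction T with
  | leaf => exact ⟨[], rfl⟩
  | node c ih =>
    obtain ⟨w, hw⟩ := ih 0
    exact ⟨0 :: w, cons_mem_leafSet_node.2 hw⟩

theorem covers_node [NeZero n] {c : Fin n → NTree n} {a : (tensorLanguage n).Term V} :
    Covers (.node c) a ↔ ∃ ts, a = tensor ts ∧ ∀ i, Covers (c i) (ts i) := by
  constructor
  · intro h
    obtain ⟨w, hw⟩ := (c 0).leafSet_nonempty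
    obtain ⟨d, hd⟩ := h (0 :: w) (NTree.cons_mem_leafSet_node.2 hw)
    obtain ⟨ts, rfl⟩ := exists_tensor_of_subtermAt_cons hd
    exact ⟨ts, rfl, fun i w hw => h (i :: w) (NTree.cons_mem_leafSet_node.2 hw)⟩
  · rintro ⟨ts, rfl, h⟩ _ ⟨i, w, hw, rfl⟩
    exact h i w hw

/-- A term is determined by its subterms at the leaves of a tree that it covers. -/
theorem eq_of_subtermAt_eq [NeZero n] {T : NTree n} {a b : (tensorLanguage n).Term V}
    (ha : Covers T a) (h : ∀ w ∈ T.leafSet, subtermAt w a = subtermAt w b) : a = b := by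
  induction T generalizing a b with
  | leaf => simpa using h [] rfl
  | node c ih =>
    have hb : Covers (.node c) b := fun w hw => by rw [← h w hw]; exact ha w hw
    obtain ⟨ts, rfl, hts⟩ := covers_node.1 ha
    obtain ⟨us, rfl, -⟩ := covers_node.1 hb
    congr 1
    funext i
    exact ih i (hts i) fun w hw => h (i :: w) (NTree.cons_mem_leafSet_node.2 hw)

/-- A tree whose leaves lead exactly to variables of `a` is the whole term tree of `a`. -/
theorem eq_termTree [NeZero n] {T : NTree n} {a : (tensorLanguage n).Term V}
    (h : ∀ w ∈ T.leafSet, ∃ y, subtermAt w a = some (FirstOrder.Language.Term.var y)) :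
    T = termTree a := by
  induction T generalizing a with
  | leaf =>
    obtain ⟨y, hy⟩ := h [] rfl
    obtain rfl : a = _ := by simpa using hy
    rfl
  | node c ih =>
    obtain ⟨ts, rfl, -⟩ := (covers_node (a := a)).1 fun w hw => ⟨_, (h w hw).choose_spec⟩
    rw [termTree_tensor]
    congr 1
    funext i
    exact ih i fun w hw => h (i :: w) (NTree.cons_mem_leafSet_node.2 hw)

/-- The term obtained from a tree by planting the term `h w` at each leaf `w`. -/
def graft : NTree n → (List (Fin n) → (tensorLanguage n).Term V) → (tensorLanguage n).Term V
  | .leaf, h => h []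
  | .node c, h => tensor fun i => graft (c i) fun w => h (i :: w)

theorem subtermAt_graft {T : NTree n} (h : List (Fin n) → (tensorLanguage n).Term V)
    {w : List (Fin n)} (hw : w ∈ T.leafSet) : subtermAt w (graft T h) = some (h w) := by
  induction T generalizing w h with
  | leaf =>
    obtain rfl : w = [] := hw
    simp [graft]
  | node c ih =>
    obtain ⟨i, w, hw, rfl⟩ := hw
    exact ih i _ hw

theorem termTree_graft_var (T : NTree n) (v : List (Fin n) → V) :
    termTree (graft T fun w => FirstOrder.Language.Term.var (v w)) = T := by
  induction T generalizing v with
  | leaf => rfl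
  | node c ih => simp [graft, ih]

/-- Any two trees have a least common expansion: a term that covers both trees covers it. -/
theorem NTree.exists_least_common_expansion [NeZero n] (V : Type*) (T T' : NTree n) :
    ∃ S, T.Expands S ∧ T'.Expands S ∧
      ∀ a : (tensorLanguage n).Term V, Covers T a → Covers T' a → Covers S a := by
  induction T generalizing T' with
  | leaf => exact ⟨T', leaf_expands T', .refl, fun _ _ h => h⟩
  | node c ih =>
    cases T' with
    | leaf => exact ⟨_, .refl, leaf_expands _, fun _ h _ => h⟩
    | node c' =>
      choose d hd hd' h using fun i => ih i (c' i)
      refine ⟨node d, Expands.children hd, Expands.children hd', fun a ha ha' => ?_⟩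
      obtain ⟨ts, rfl, hts⟩ := covers_node.1 ha
      obtain ⟨us, hu, hus⟩ := covers_node.1 ha'
      obtain rfl := tensor_injective hu
      exact covers_node.2 ⟨ts, rfl, fun i => h i _ (hts i) (hus i)⟩

theorem Covers.expands [NeZero n] {T : NTree n} {a : (tensorLanguage n).Term V}
    (h : Covers T a) : T.Expands (termTree a) := by
  induction T generalizing a with
  | leaf => exact NTree.leaf_expands _
  | node c ih =>
    obtain ⟨ts, rfl, hts⟩ := covers_node.1 h
    exact NTree.Expands.children fun i => ih i (hts i)

theorem subst_eq_var {c : (tensorLanguage n).Term V} {φ : V → (tensorLanguage n).Term V} {y : V}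
    (h : c.subst φ = FirstOrder.Language.Term.var y) :
    ∃ z, c = FirstOrder.Language.Term.var z := by
  induction c using tensor_induction with
  | var z => exact ⟨z, rfl⟩
  | tensor ts _ => simp [tensor, FirstOrder.Language.Term.subst] at h

end Subterms

/-! ### The operator of a tree diagram -/

namespace TreeDiagram

variable {n : ℕ} {V : Type*}

/-- The graph of the operator on terms given by a tree diagram `(T₁, T₂, σ)`: the subterm of `a`
at each leaf `l` of `T₁` is the subterm of `b` at `σ l`. -/
def Graph (D : TreeDiagram n) (a b : (tensorLanguage n).Term V) : Prop :=
  ∀ l : D.src.Leaf, ∃ c, subtermAt l.1 a = some c ∧ subtermAt (D.σ l).1 b = some c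

theorem Graph.symm {D : TreeDiagram n} {a b : (tensorLanguage n).Term V} (h : D.Graph a b) :
    D.symm.Graph b a := by
  intro (l : D.tgt.Leaf)
  obtain ⟨c, h₁, h₂⟩ := h (D.σ.symm l)
  exact ⟨c, by simpa using h₂, h₁⟩

theorem Graph.covers_src {D : TreeDiagram n} {a b : (tensorLanguage n).Term V}
    (h : D.Graph a b) : Covers D.src a := fun w hw => by
  obtain ⟨c, h₁, -⟩ := h ⟨w, hw⟩
  exact ⟨c, h₁⟩

theorem Graph.covers_tgt {D : TreeDiagram n} {a b : (tensorLanguage n).Term V}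
    (h : D.Graph a b) : Covers D.tgt b := h.symm.covers_src

/-- The subterm at the expanded leaf is recovered from its arguments; as `n` is positive, these
show that it is not a variable. -/
theorem IsSimpleExpansion.graph [NeZero n] {D D' : TreeDiagram n} (h : D.IsSimpleExpansion D')
    {a b : (tensorLanguage n).Term V} (hab : D'.Graph a b) : D.Graph a b := by
  obtain ⟨l, h₁, -, h₃, h₄⟩ := h
  have hmem : ∀ w, (w ∈ D.src.leafSet ∧ w ≠ l) ∨ (∃ i, w = l.1 ++ [i]) → w ∈ D'.src.leafSet :=
    fun w hw => by rw [h₁]; exact (NTree.mem_leafSet_expandAt l.2).2 hw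
  intro k
  by_cases hk : k = l
  · subst hk
    have key : ∀ i, ∃ c, subtermAt (k.1 ++ [i]) a = some c ∧
        subtermAt ((D.σ k).1 ++ [i]) b = some c := fun i => by
      have := hab ⟨k.1 ++ [i], hmem _ (.inr ⟨i, rfl⟩)⟩
      rwa [h₄ i ⟨_, _⟩ rfl] at this
    simp only [subtermAt_append, Option.bind_eq_some_iff] at key
    obtain ⟨_, ⟨p, hp, hp'⟩, q, hq, hq'⟩ := key 0
    obtain ⟨ts, rfl⟩ := exists_tensor_of_subtermAt_cons hp'
    obtain ⟨us, rfl⟩ := exists_tensor_of_subtermAt_cons hq'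
    suffices ts = us from ⟨_, hp, this ▸ hq⟩
    funext i
    obtain ⟨c, ⟨p, hp₁, hp₂⟩, q, hq₁, hq₂⟩ := key i
    obtain rfl := Option.some.inj (hp.symm.trans hp₁)
    obtain rfl := Option.some.inj (hq.symm.trans hq₁)
    exact Option.some.inj ((hp₂.trans hq₂.symm :))
  · have hk' := hmem k.1 (.inl ⟨k.2, fun e => hk (Subtype.ext e)⟩)
    have := hab ⟨k.1, hk'⟩
    rwa [h₃ k ⟨k.1, hk'⟩ hk rfl] at this

/-- Expanding a diagram restricts its operator to the terms that cover the larger tree. -/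
theorem Expands.graph_iff [NeZero n] {D D' : TreeDiagram n} (h : D.Expands D')
    {a b : (tensorLanguage n).Term V} : D'.Graph a b ↔ D.Graph a b ∧ Covers D'.src a := by
  constructor
  · intro hab
    refine ⟨?_, hab.covers_src⟩
    induction h with
    | refl => exact hab
    | tail _ h ih => exact ih (h.graph hab)
  · rintro ⟨hab, ha⟩ k'
    obtain ⟨k, w, e₁, e₂⟩ := h.exists_prefix k'
    obtain ⟨c, h₁, h₂⟩ := hab k
    obtain ⟨d, hd⟩ := ha k'.1 k'.2
    refine ⟨d, hd, ?_⟩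
    rw [e₁, subtermAt_append, h₁] at hd
    rw [e₂, subtermAt_append, h₂]
    exact hd

theorem Expands.graph_iff_tgt [NeZero n] {D D' : TreeDiagram n} (h : D.Expands D')
    {a b : (tensorLanguage n).Term V} : D'.Graph a b ↔ D.Graph a b ∧ Covers D'.tgt b := by
  constructor
  · exact fun hab => ⟨(h.graph_iff.1 hab).1, hab.covers_tgt⟩
  · exact fun hab => (h.symm.graph_iff.2 ⟨hab.1.symm, hab.2⟩).symm

/-- Diagrams that meet in a tree `B` compose like their operators; the intermediate term is
rebuilt by planting the common subterms at the leaves of `B`. -/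
theorem graph_trans {A B C : NTree n} {σ : A.Leaf ≃ B.Leaf} {τ : B.Leaf ≃ C.Leaf}
    {a b : (tensorLanguage n).Term V} :
    (⟨A, C, σ.trans τ⟩ : TreeDiagram n).Graph a b ↔
      ∃ c, (⟨A, B, σ⟩ : TreeDiagram n).Graph a c ∧ (⟨B, C, τ⟩ : TreeDiagram n).Graph c b := by
  classical
  constructor
  · intro h
    choose g h₁ h₂ using h
    dsimp only at g h₁ h₂
    refine ⟨graft B fun w => if hw : w ∈ B.leafSet then g (σ.symm ⟨w, hw⟩) else a, fun l => ?_,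
      fun (l : B.Leaf) => ?_⟩
    · refine ⟨g l, h₁ l, ?_⟩
      rw [subtermAt_graft _ (σ l).2]
      simp
    · refine ⟨g (σ.symm l), ?_, by simpa using h₂ (σ.symm l)⟩
      rw [subtermAt_graft _ l.2]
      simp
  · rintro ⟨c, h₁, h₂⟩ l
    obtain ⟨d, hd, hd'⟩ := h₁ l
    obtain ⟨e, he, he'⟩ := h₂ (σ l)
    obtain rfl := Option.some.inj (hd'.symm.trans he)
    exact ⟨d, hd, he'⟩

/-- If the leaves of two terms carry matching variables, without repetition, then the operator
`ρ_{s,t}` is the operator of the diagram that matches these leaves. -/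
theorem substGraph_iff [NeZero n] {D : TreeDiagram n} {s t a b : (tensorLanguage n).Term V}
    {v : D.src.Leaf → V} (hv : Function.Injective v)
    (hs : ∀ l, subtermAt l.1 s = some (FirstOrder.Language.Term.var (v l)))
    (ht : ∀ l, subtermAt (D.σ l).1 t = some (FirstOrder.Language.Term.var (v l))) :
    SubstGraph s t a b ↔ D.Graph a b := by
  constructor
  · rintro ⟨φ, rfl, rfl⟩ l
    exact ⟨φ (v l), subtermAt_subst (hs l) φ, subtermAt_subst (ht l) φ⟩
  · intro h
    choose g h₁ h₂ using h
    have hφ : ∀ l, Function.extend v g FirstOrder.Language.Term.var (v l) = g l :=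
      hv.extend_apply _ _
    refine ⟨Function.extend v g FirstOrder.Language.Term.var,
      eq_of_subtermAt_eq (T := D.src) (fun w hw => ⟨_, subtermAt_subst (hs ⟨w, hw⟩) _⟩)
        fun w hw => ?_,
      eq_of_subtermAt_eq (T := D.tgt) (fun w hw => ?_) fun w hw => ?_⟩
    · rw [subtermAt_subst (hs ⟨w, hw⟩), h₁ ⟨w, hw⟩]
      exact congrArg some (hφ _)
    · obtain ⟨l, hl⟩ := D.σ.surjective ⟨w, hw⟩
      have := subtermAt_subst (ht l) (Function.extend v g FirstOrder.Language.Term.var)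
      rw [hl] at this
      exact ⟨_, this⟩
    · obtain ⟨l, hl⟩ := D.σ.surjective ⟨w, hw⟩
      have h₁ := subtermAt_subst (ht l) (Function.extend v g FirstOrder.Language.Term.var)
      have h₂ := h₂ l
      rw [hl] at h₁ h₂
      rw [h₁, h₂]
      exact congrArg some (hφ _)

/-- The operator of a diagram is some `ρ_{s,t}`: label the leaves of the two trees with distinct
variables, in the way prescribed by the bijection. -/
theorem exists_substGraph_iff [NeZero n] [Infinite V] (D : TreeDiagram n) :
    ∃ s t : (tensorLanguage n).Term V, termTree s = D.src ∧ termTree t = D.tgt ∧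
      ∀ a b, SubstGraph s t a b ↔ D.Graph a b := by
  classical
  obtain ⟨v⟩ : Nonempty (List (Fin n) ↪ V) := by
    rw [← Cardinal.lift_mk_le']
    exact (Cardinal.lift_le_aleph0.2 (Cardinal.mk_le_aleph0)).trans
      (Cardinal.aleph0_le_lift.2 (Cardinal.aleph0_le_mk V))
  refine ⟨graft D.src fun w => .var (v w),
    graft D.tgt fun w => .var (if hw : w ∈ D.tgt.leafSet then v (D.σ.symm ⟨w, hw⟩).1 else v w),
    termTree_graft_var _ _, termTree_graft_var _ _, fun a b =>
      substGraph_iff (v := fun l => v l.1) (v.injective.comp Subtype.val_injective)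
        (fun l => subtermAt_graft _ l.2) fun l => ?_⟩
  rw [subtermAt_graft _ (D.σ l).2]
  simp

/-- All seeds of the operator of a diagram have the trees of the diagram as their term trees. -/
theorem termTree_of_substGraph_iff [NeZero n] [Infinite V] {D : TreeDiagram n}
    {s t : (tensorLanguage n).Term V} (h : ∀ a b, SubstGraph s t a b ↔ D.Graph a b) :
    termTree s = D.src ∧ termTree t = D.tgt := by
  obtain ⟨s₀, t₀, hs₀, ht₀, h₀⟩ := D.exists_substGraph_iff (V := V)
  have hst : D.Graph s t := (h s t).1 ⟨_, subst_var s, subst_var t⟩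
  obtain ⟨φ, hφ, hφ'⟩ := (h s₀ t₀).2 ((h₀ s₀ t₀).1 ⟨_, subst_var s₀, subst_var t₀⟩)
  have key : ∀ (T : NTree n) (r r₀ : (tensorLanguage n).Term V), Covers T r → r.subst φ = r₀ →
      termTree r₀ = T → termTree r = T := by
    rintro T r _ hr rfl hT
    refine (eq_termTree fun w hw => ?_).symm
    obtain ⟨c, hc⟩ := hr w hw
    obtain ⟨y, hy⟩ := mem_leafSet_termTree.1 (hT.symm ▸ hw)
    obtain ⟨z, rfl⟩ := subst_eq_var (Option.some.inj ((subtermAt_subst hc φ).symm.trans hy))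
    exact ⟨z, hc⟩
  exact ⟨key _ _ _ hst.covers_src hφ hs₀, key _ _ _ hst.covers_tgt hφ' ht₀⟩

end TreeDiagram

/-! ### Operators in the structure monoid are given by tree diagrams -/

namespace TreeDiagram

variable {n : ℕ} {V : Type*}

/-- A partial function on terms is represented by a diagram if the diagram is order-preserving
and the partial function is its operator. -/
def Represents (D : TreeDiagram n) (ρ : PartialEndo ((tensorLanguage n).Term V)) : Prop :=
  D.OrderPreserving ∧ ∀ a b, ρ.Maps a b ↔ D.Graph a b

theorem represents_one :
    (⟨.leaf, .leaf, Equiv.refl _⟩ : TreeDiagram n).Represents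
      (1 : PartialEndo ((tensorLanguage n).Term V)) := by
  refine ⟨strictMono_id, fun a b => ?_⟩
  rw [PartialEndo.maps_one]
  constructor
  · rintro rfl ⟨_, rfl⟩
    exact ⟨b, subtermAt_nil b, subtermAt_nil b⟩
  · intro h
    obtain ⟨c, h₁, h₂⟩ := h ⟨[], rfl⟩
    exact (Option.some.inj h₂).trans (Option.some.inj h₁).symm

/-- The product of two representable operators is representable, by a diagram whose symbol is the
product of the two symbols. -/
theorem Represents.exists_mul [NeZero n] {D E : TreeDiagram n}
    {ρ ρ' : PartialEndo ((tensorLanguage n).Term V)} (hD : D.Represents ρ) (hE : E.Represents ρ') :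
    ∃ F : TreeDiagram n, F.Represents (ρ * ρ') ∧ HigmanThompson.symbol F.src F.tgt F.σ =
      HigmanThompson.symbol D.src D.tgt D.σ * HigmanThompson.symbol E.src E.tgt E.σ := by
  obtain ⟨S, hS, hS', hcov⟩ := NTree.exists_least_common_expansion V D.tgt E.src
  obtain ⟨⟨A, _, σ⟩, hD', rfl⟩ := D.exists_expands_tgt hS
  obtain ⟨⟨_, C, τ⟩, hE', e⟩ := E.exists_expands_src hS'
  dsimp only at e hcov
  subst e
  refine ⟨⟨A, C, σ.trans τ⟩,
    ⟨(hE'.orderPreserving hE.1).comp (hD'.orderPreserving hD.1), fun a b => ?_⟩, ?_⟩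
  · rw [PartialEndo.maps_mul, graph_trans]
    refine exists_congr fun c => ?_
    rw [hD.2, hE.2, hD'.graph_iff_tgt, hE'.graph_iff]
    constructor
    · rintro ⟨h, h'⟩
      have := hcov c h.covers_tgt h'.covers_src
      exact ⟨⟨h, this⟩, h', this⟩
    · rintro ⟨⟨h, -⟩, h', -⟩
      exact ⟨h, h'⟩
  · rw [HigmanThompson.symbol_eq_of_expands hD', HigmanThompson.symbol_eq_of_expands hE',
      HigmanThompson.symbol_mul_symbol]

theorem exists_equiv_of_strictMonoOn {A B : NTree n} {f : List (Fin n) → List (Fin n)}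
    (hf : StrictMonoOn f A.leafSet) (hAB : f '' A.leafSet = B.leafSet) :
    ∃ σ : A.Leaf ≃ B.Leaf, StrictMono σ ∧ ∀ l, (σ l).1 = f l.1 :=
  ⟨((hf.orderIso f _).trans (OrderIso.setCongr _ _ hAB)).toEquiv,
    ((hf.orderIso f _).trans (OrderIso.setCongr _ _ hAB)).strictMono, fun _ => rfl⟩

/-- The translate of an order-preserving diagram to the `i`-th child of the root. -/
theorem OrderPreserving.exists_translate [NeZero n] {D : TreeDiagram n} (hD : D.OrderPreserving)
    (V : Type*) (i : Fin n) :
    ∃ D' : TreeDiagram n, D'.OrderPreserving ∧ ∀ a b : (tensorLanguage n).Term V,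
      D'.Graph a b ↔ ∃ ts c, a = tensor ts ∧ b = tensor (Function.update ts i c) ∧
        D.Graph (ts i) c := by
  classical
  let g : List (Fin n) → List (Fin n) :=
    fun w => if h : w ∈ D.src.leafSet then (D.σ ⟨w, h⟩).1 else w
  -- The translate of `σ` fixes the new leaves `[j]`, `j ≠ i`, and acts by `σ` below `i`.
  let f : List (Fin n) → List (Fin n)
    | [] => []
    | j :: w => if j = i then j :: g w else j :: w
  have hg : ∀ l : D.src.Leaf, g l.1 = (D.σ l).1 := fun l => by simp [g]
  have hmem : ∀ (T : NTree n) (w : List (Fin n)),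
      w ∈ (NTree.node (Function.update (fun _ => NTree.leaf) i T)).leafSet ↔
        (∃ v ∈ T.leafSet, w = i :: v) ∨ ∃ j, j ≠ i ∧ w = [j] := by
    intro T w
    cases w with
    | nil => simp [NTree.nil_mem_leafSet_node]
    | cons j w =>
      rw [NTree.cons_mem_leafSet_node]
      by_cases hj : j = i
      · subst hj; simp
      · simp [hj, NTree.leafSet]
  have hfi : ∀ w, f (i :: w) = i :: g w := fun w => if_pos rfl
  have hfj : ∀ j w, j ≠ i → f (j :: w) = j :: w := fun j w hj => if_neg hj
  obtain ⟨σ, hσ, hσf⟩ := exists_equiv_of_strictMonoOn (f := f)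
    (A := NTree.node (Function.update (fun _ => NTree.leaf) i D.src))
    (B := NTree.node (Function.update (fun _ => NTree.leaf) i D.tgt)) (by
      intro u hu v hv huv
      rcases (hmem _ _).1 hu with ⟨u, hu', rfl⟩ | ⟨j, hj, rfl⟩ <;>
        rcases (hmem _ _).1 hv with ⟨v, hv', rfl⟩ | ⟨k, hk, rfl⟩
      · rw [hfi, hfi, hg ⟨u, hu'⟩, hg ⟨v, hv'⟩]
        simp only [List.cons_lt_cons_iff, lt_irrefl, false_or, true_and] at huv ⊢
        exact hD (a := ⟨u, hu'⟩) (b := ⟨v, hv'⟩) huv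
      · rw [hfi, hfj _ _ hk]
        simpa [List.cons_lt_cons_iff, hk.symm] using huv
      · rw [hfi, hfj _ _ hj]
        simpa [List.cons_lt_cons_iff, hj] using huv
      · rwa [hfj _ _ hj, hfj _ _ hk]) (by
      ext w
      rw [hmem]
      constructor
      · rintro ⟨u, hu, rfl⟩
        rcases (hmem _ _).1 hu with ⟨u, hu', rfl⟩ | ⟨j, hj, rfl⟩
        · exact .inl ⟨_, (D.σ ⟨u, hu'⟩).2, by rw [hfi, hg ⟨u, hu'⟩]⟩
        · exact .inr ⟨j, hj, hfj _ _ hj⟩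
      · rintro (⟨v, hv, rfl⟩ | ⟨j, hj, rfl⟩)
        · refine ⟨i :: (D.σ.symm ⟨v, hv⟩).1, (hmem _ _).2 (.inl ⟨_, (D.σ.symm ⟨v, hv⟩).2, rfl⟩), ?_⟩
          rw [hfi, hg, Equiv.apply_symm_apply]
        · exact ⟨[j], (hmem _ _).2 (.inr ⟨j, hj, rfl⟩), hfj _ _ hj⟩)
  refine ⟨⟨_, _, σ⟩, hσ, fun a b => ?_⟩
  constructor
  · intro h
    obtain ⟨ts, rfl, -⟩ := covers_node.1 h.covers_src
    obtain ⟨us, rfl, -⟩ := covers_node.1 h.covers_tgt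
    refine ⟨ts, us i, rfl, ?_, fun l => ?_⟩
    · congr 1
      funext j
      by_cases hj : j = i
      · subst hj; simp
      · obtain ⟨c, h₁, h₂⟩ := h ⟨[j], (hmem _ _).2 (.inr ⟨j, hj, rfl⟩)⟩
        rw [hσf, hfj _ _ hj] at h₂
        simp only [subtermAt_cons_tensor, subtermAt_nil, Option.some.injEq] at h₁ h₂
        rw [Function.update_of_ne hj, h₁, h₂]
    · obtain ⟨c, h₁, h₂⟩ := h ⟨i :: l.1, (hmem _ _).2 (.inl ⟨_, l.2, rfl⟩)⟩
      rw [hσf, hfi, hg] at h₂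
      exact ⟨c, h₁, h₂⟩
  · rintro ⟨ts, c, rfl, rfl, h⟩ ⟨w, hw⟩
    rw [hσf]
    dsimp only at hw ⊢
    rcases (hmem _ _).1 hw with ⟨u, hu, rfl⟩ | ⟨j, hj, rfl⟩
    · rw [hfi, hg ⟨u, hu⟩]
      simpa using h ⟨u, hu⟩
    · rw [hfj _ _ hj]
      simp [hj]

/-- The path to the variable number `j` in `⊗(x₀, …, ⊗(x_p, …, x_{p+n-1}), …, x_{2n-2})`. -/
def nestedPath (p : Fin n) (j : Fin (2 * n - 1)) : List (Fin n) :=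
  if h : j.1 < p then [⟨j, by omega⟩]
  else if h' : j.1 < p + n then [p, ⟨j - p, by omega⟩]
  else [⟨j - (n - 1), by omega⟩]

theorem subtermAt_nestedPath (x : Fin (2 * n - 1) → V) (p : Fin n) (j : Fin (2 * n - 1)) :
    subtermAt (nestedPath p j) (nestedTensor x p) =
      some (FirstOrder.Language.Term.var (x j)) := by
  unfold nestedPath nestedTensor
  split_ifs with h h'
  · rw [subtermAt_cons_tensor, if_pos (by simpa [Fin.lt_def] using h), subtermAt_nil]
  · rw [subtermAt_cons_tensor, if_neg (lt_irrefl _), if_pos rfl, subtermAt_cons_tensor,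
      subtermAt_nil]
    congr 3
    exact Fin.ext (by simp; omega)
  · rw [subtermAt_cons_tensor, if_neg (by simp [Fin.lt_def]; omega),
      if_neg (by simp [Fin.ext_iff]; omega), subtermAt_nil]
    congr 3
    exact Fin.ext (by simp; omega)

theorem strictMono_nestedPath (p : Fin n) : StrictMono (nestedPath p) := by
  intro i j hij
  have hij : i.1 < j.1 := hij
  unfold nestedPath
  split_ifs <;> simp only [List.cons_lt_cons_iff, Fin.lt_def, Fin.ext_iff, List.not_lt_nil,
    List.nil_lt_cons, and_true, and_false, or_false, true_and] <;> omega

theorem mem_leafSet_nestedTensor (x : Fin (2 * n - 1) → V) (p : Fin n) {w : List (Fin n)} :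
    w ∈ (termTree (nestedTensor x p)).leafSet ↔ ∃ j, nestedPath p j = w := by
  constructor
  · unfold nestedTensor nestedPath
    rw [termTree_tensor]
    rintro ⟨i, v, hv, rfl⟩
    dsimp only at hv
    split_ifs at hv with h h'
    · obtain rfl : v = [] := hv
      exact ⟨⟨i, by omega⟩, dif_pos (show i.1 < p.1 from h)⟩
    · obtain ⟨k, v, hv, rfl⟩ := hv
      obtain rfl : v = [] := hv
      subst h'
      exact ⟨⟨i + k, by omega⟩, by simp⟩
    · obtain rfl : v = [] := hv
      have h₁ : p.1 < i.1 := lt_of_le_of_ne (not_lt.1 h) fun e => h' (Fin.ext e.symm)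
      refine ⟨⟨i + n - 1, by omega⟩, ?_⟩
      rw [dif_neg (by simp; omega), dif_neg (by simp; omega)]
      simp [Fin.ext_iff]
      omega
  · rintro ⟨j, rfl⟩
    exact mem_leafSet_termTree.2 ⟨_, subtermAt_nestedPath x p j⟩

/-- The operators `ρ_{s,t}` of the equations of `C_n` are given by diagrams: the variables occur in
the order of their numbers in all the terms `⊗(x₀, …, ⊗(x_p, …, x_{p+n-1}), …, x_{2n-2})`. -/
theorem exists_graph_nestedTensor [NeZero n] (x : Fin (2 * n - 1) ↪ V) (p q : Fin n) :
    ∃ D : TreeDiagram n, D.OrderPreserving ∧ ∀ a b : (tensorLanguage n).Term V,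
      SubstGraph (nestedTensor x p) (nestedTensor x q) a b ↔ D.Graph a b := by
  have key : ∀ p : Fin n, ∃ e : Fin (2 * n - 1) ≃o (termTree (nestedTensor x p)).Leaf,
      ∀ j, (e j).1 = nestedPath p j := fun p =>
    ⟨StrictMono.orderIsoOfSurjective
      (fun j => ⟨nestedPath p j, (mem_leafSet_nestedTensor x p).2 ⟨j, rfl⟩⟩)
      (strictMono_nestedPath p) (by
        rintro ⟨w, hw⟩
        obtain ⟨j, rfl⟩ := (mem_leafSet_nestedTensor x p).1 hw
        exact ⟨j, rfl⟩), fun j => rfl⟩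
  obtain ⟨e, he⟩ := key p
  obtain ⟨e', he'⟩ := key q
  refine ⟨⟨_, _, (e.symm.trans e').toEquiv⟩, (e.symm.trans e').strictMono, fun a b => ?_⟩
  refine substGraph_iff (v := fun l => x (e.symm l)) (x.injective.comp e.symm.injective)
    (fun (l : (termTree (nestedTensor x p)).Leaf) => ?_)
    fun (l : (termTree (nestedTensor x p)).Leaf) => ?_
  · obtain ⟨j, rfl⟩ := e.surjective l
    rw [he, subtermAt_nestedPath, e.symm_apply_apply]
  · change subtermAt (e' (e.symm l)).1 _ = _
    rw [he', subtermAt_nestedPath]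

end TreeDiagram

section Catalan

variable {n : ℕ} {V : Type*}

theorem exists_represents_translatedOp [NeZero n] (x : Fin (2 * n - 1) ↪ V)
    {s t : (tensorLanguage n).Term V}
    (h : (s, t) ∈ (catalanTheory n x).eqns ∨ (t, s) ∈ (catalanTheory n x).eqns)
    (α : TermAddress (tensorLanguage n)) :
    ∃ D : TreeDiagram n, D.Represents (translatedOp s t α) := by
  simp only [TreeDiagram.Represents, (catalanTheory n x).maps_translatedOp h]
  obtain ⟨D, hD, hst⟩ : ∃ D : TreeDiagram n, D.OrderPreserving ∧
      ∀ a b : (tensorLanguage n).Term V, SubstGraph s t a b ↔ D.Graph a b := by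
    rcases h with ⟨i, _, hi, h⟩ | ⟨i, _, hi, h⟩ <;> obtain ⟨rfl, rfl⟩ := Prod.mk.inj h <;>
      exact TreeDiagram.exists_graph_nestedTensor x _ _
  induction α with
  | nil =>
    refine ⟨D, hD, fun a b => ?_⟩
    rw [← hst]
    exact ⟨fun h => by cases h; assumption, .root⟩
  | cons A α ih =>
    obtain ⟨k, f, i⟩ := A
    change TensorSymbol n k at f
    cases f
    obtain ⟨E, hE, hE'⟩ := ih
    obtain ⟨F, hF, hF'⟩ := hE.exists_translate V i
    refine ⟨F, hF, fun a b => ?_⟩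
    rw [hF']
    constructor
    · intro h
      cases h with
      | step _ _ args h => exact ⟨args, _, rfl, rfl, (hE' _ _).1 h⟩
    · rintro ⟨ts, c, rfl, rfl, h⟩
      exact .step _ i ts ((hE' _ _).2 h)

/-- Every element of the structure monoid is the operator of an order-preserving tree diagram. -/
theorem exists_represents [NeZero n] (x : Fin (2 * n - 1) ↪ V) (ρ : (catalanTheory n x).Struct) :
    ∃ D : TreeDiagram n, D.Represents ρ.1 := by
  obtain ⟨ρ, hρ⟩ := ρ
  induction hρ using Submonoid.closure_induction with
  | mem ρ hρ =>
    obtain ⟨s, t, α, hst, rfl⟩ := id hρ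
    exact exists_represents_translatedOp x hst α
  | one => exact ⟨_, TreeDiagram.represents_one⟩
  | mul ρ ρ' _ _ ih ih' =>
    obtain ⟨D, hD⟩ := ih
    obtain ⟨E, hE⟩ := ih'
    obtain ⟨F, hF, -⟩ := hD.exists_mul hE
    exact ⟨F, hF⟩

end Catalan

/-! ### Uniqueness of the diagram, and the kernel -/

namespace TreeDiagram

variable {n : ℕ} {V : Type*}

theorem _root_.NTree.finite_leafSet (T : NTree n) : T.leafSet.Finite := by
  induction T with
  | leaf => exact Set.finite_singleton _
  | node c ih =>
    refine (Set.finite_iUnion fun i => (ih i).image (List.cons i)).subset ?_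
    rintro _ ⟨i, v, hv, rfl⟩
    exact Set.mem_iUnion.2 ⟨i, v, hv, rfl⟩

instance (T : NTree n) : Finite T.Leaf := T.finite_leafSet

/-- The bijection of an order-preserving diagram, as an order isomorphism. -/
def OrderPreserving.orderIso {D : TreeDiagram n} (hD : D.OrderPreserving) :
    D.src.Leaf ≃o D.tgt.Leaf where
  toEquiv := D.σ
  map_rel_iff' := StrictMono.le_iff_le hD

theorem OrderPreserving.ext {D E : TreeDiagram n} (hD : D.OrderPreserving)
    (hE : E.OrderPreserving) (hsrc : D.src = E.src) (htgt : D.tgt = E.tgt) : D = E := by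
  obtain ⟨A, B, σ⟩ := D
  obtain ⟨A', B', τ⟩ := E
  dsimp only at hsrc htgt
  subst hsrc htgt
  have : hD.orderIso = hE.orderIso := Subsingleton.elim _ _
  exact congrArg _ (congrArg RelIso.toEquiv this)

theorem Represents.termTree_eq [NeZero n] [Infinite V] {D : TreeDiagram n}
    {ρ : PartialEndo ((tensorLanguage n).Term V)} (h : D.Represents ρ)
    {s t : (tensorLanguage n).Term V} (hst : IsSeed ρ s t) :
    termTree s = D.src ∧ termTree t = D.tgt :=
  termTree_of_substGraph_iff fun a b => (hst a b).symm.trans (h.2 a b)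

theorem Represents.unique [NeZero n] [Infinite V] {D E : TreeDiagram n}
    {ρ : PartialEndo ((tensorLanguage n).Term V)} (hD : D.Represents ρ) (hE : E.Represents ρ) :
    D = E := by
  obtain ⟨s, t, hs, ht, hst⟩ := E.exists_substGraph_iff (V := V)
  have := hD.termTree_eq fun a b => (hE.2 a b).trans (hst a b).symm
  exact hD.1.ext hE.1 (this.1.symm.trans hs) (this.2.symm.trans ht)

theorem _root_.NTree.Expands.exists_append_mem [NeZero n] {T T' : NTree n} (h : T.Expands T')
    {w : List (Fin n)} (hw : w ∈ T.leafSet) : ∃ v, w ++ v ∈ T'.leafSet := by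
  induction h with
  | refl => exact ⟨[], by simpa using hw⟩
  | tail _ h ih =>
    obtain ⟨l, hl, rfl⟩ := h
    obtain ⟨v, hv⟩ := ih
    by_cases hwl : w ++ v = l
    · exact ⟨v ++ [0], (NTree.mem_leafSet_expandAt hl).2 (.inr ⟨0, by rw [← hwl]; simp⟩)⟩
    · exact ⟨v, (NTree.mem_leafSet_expandAt hl).2 (.inl ⟨hv, hwl⟩)⟩

/-- A diagram whose symbol is trivial does not move any leaf. -/
theorem apply_eq_of_symbol_eq_one [NeZero n] {D : TreeDiagram n}
    (h : HigmanThompson.symbol D.src D.tgt D.σ = 1) (l : D.src.Leaf) : (D.σ l).1 = l.1 := by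
  obtain ⟨E, hE, hE'⟩ : ∃ E, D.Expands E ∧ Expands ⟨.leaf, .leaf, Equiv.refl _⟩ E :=
    Quotient.exact h
  obtain ⟨v, hv⟩ := hE.src_expands.exists_append_mem l.2
  obtain ⟨k, w, e₁, e₂⟩ := hE.exists_prefix ⟨_, hv⟩
  obtain ⟨k', w', e₁', e₂'⟩ := hE'.exists_prefix ⟨_, hv⟩
  obtain ⟨hk, rfl⟩ := NTree.append_inj_of_mem l.2 k.2 e₁
  obtain rfl := Subtype.ext hk
  exact List.append_cancel_right (e₂.symm.trans (e₂'.trans e₁'.symm))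

/-- An operator whose diagram has trivial symbol is a restriction of the identity. -/
theorem Represents.isIdempotentElem [NeZero n] {D : TreeDiagram n}
    {ρ : PartialEndo ((tensorLanguage n).Term V)} (hD : D.Represents ρ)
    (h : HigmanThompson.symbol D.src D.tgt D.σ = 1) : IsIdempotentElem ρ := by
  have key : ∀ a b, ρ.Maps a b → a = b := fun a b hab => by
    refine eq_of_subtermAt_eq ((hD.2 a b).1 hab).covers_src fun w hw => ?_
    obtain ⟨c, h₁, h₂⟩ := (hD.2 a b).1 hab ⟨w, hw⟩
    rw [apply_eq_of_symbol_eq_one h] at h₂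
    exact h₁.trans h₂.symm
  refine PartialEndo.ext_maps fun a b => PartialEndo.maps_mul.trans ⟨?_, fun hab => ?_⟩
  · rintro ⟨c, hac, hcb⟩
    rwa [key _ _ hac]
  · obtain rfl := key _ _ hab
    exact ⟨a, hab, hab⟩

end TreeDiagram

/-! ### Inner vertices, nested trees and combs -/

namespace NTree

variable {n : ℕ}

/-- The number of inner vertices of a tree. -/
def numNodes : NTree n → ℕ
  | leaf => 0
  | node c => 1 + ∑ i, (c i).numNodes

/-- A tree with `N` inner vertices has `1 + (n - 1) N` leaves, written without subtraction. -/
theorem card_leaf_add_numNodes (T : NTree n) :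
    Nat.card T.Leaf + T.numNodes = 1 + n * T.numNodes := by
  induction T with
  | leaf => simp [numNodes, leafSet]
  | node c ih =>
    let e : (node c).Leaf ≃ Σ i, (c i).Leaf := Equiv.symm <| Equiv.ofBijective
      (fun p => ⟨p.1 :: p.2.1, cons_mem_leafSet_node.2 p.2.2⟩) (by
        constructor
        · rintro ⟨i, v, hv⟩ ⟨j, w, hw⟩ h
          obtain ⟨rfl, rfl⟩ := List.cons.inj (congrArg Subtype.val h)
          rfl
        · rintro ⟨_, i, v, hv, rfl⟩
          exact ⟨⟨i, v, hv⟩, rfl⟩)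
    have hsum := Finset.sum_congr (rfl : (Finset.univ : Finset (Fin n)) = _) fun i _ => ih i
    rw [Finset.sum_add_distrib, Finset.sum_add_distrib, ← Finset.mul_sum] at hsum
    simp only [Finset.sum_const, Finset.card_univ, Fintype.card_fin, smul_eq_mul, mul_one] at hsum
    rw [Nat.card_congr e, Nat.card_sigma, numNodes, mul_add, mul_one]
    omega

theorem numNodes_eq_of_card_eq (hn : 2 ≤ n) {T T' : NTree n}
    (h : Nat.card T.Leaf = Nat.card T'.Leaf) : T.numNodes = T'.numNodes := by
  have h₁ := T.card_leaf_add_numNodes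
  have h₂ := T'.card_leaf_add_numNodes
  obtain ⟨m, rfl⟩ := Nat.exists_eq_add_of_le hn
  rw [add_mul] at h₁ h₂
  have : (1 + m) * T.numNodes = (1 + m) * T'.numNodes := by
    rw [add_mul, add_mul]; omega
  exact Nat.eq_of_mul_eq_mul_left (by omega) this

/-- The tree with a vertex below the root, in position `p`, and `2n - 1` given trees attached. -/
def nested (p : Fin n) (y : Fin (2 * n - 1) → NTree n) : NTree n :=
  node fun j =>
    if j < p then y ⟨j, by omega⟩
    else if j = p then node fun k => y ⟨p + k, by omega⟩
    else y ⟨j + n - 1, by omega⟩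

/-- A tree whose root has an inner vertex as its `p`-th child is of the form `nested p y`, and the
first of the trees `y` are the children of the root before `p`, and then the children of that
vertex. -/
theorem exists_eq_nested {p : Fin n} {c d : Fin n → NTree n} (h : c p = node d) :
    ∃ y : Fin (2 * n - 1) → NTree n, node c = nested p y ∧
      (∀ j, j.1 < p.1 → ∀ hj, y j = c ⟨j, hj⟩) ∧
      ∀ j, p.1 ≤ j.1 → ∀ hj : j.1 - p < n, y j = d ⟨j - p, hj⟩ := by
  refine ⟨fun j => if h₁ : j.1 < p.1 then c ⟨j, by omega⟩
    else if h₂ : j.1 - p < n then d ⟨j - p, h₂⟩ else c ⟨j - (n - 1), by omega⟩, ?_, ?_, ?_⟩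
  · unfold nested
    congr 1
    funext j
    dsimp only
    by_cases h₁ : j < p
    · rw [if_pos h₁, dif_pos (show j.1 < p.1 from h₁)]
    rw [if_neg h₁]
    by_cases h₂ : j = p
    · subst h₂
      rw [h, if_pos rfl]
      congr 1
      funext k
      simp
    · have h₃ : p.1 < j.1 := lt_of_le_of_ne (not_lt.1 h₁) fun e => h₂ (Fin.ext e.symm)
      rw [if_neg h₂, dif_neg (by omega), dif_neg (by omega)]
      congr 1
      exact Fin.ext (by simp; omega)
  · intro j h₁ hj
    exact dif_pos h₁
  · intro j h₁ hj
    exact (dif_neg (by omega)).trans (dif_pos hj)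

/-- The sum over the children of the root in `nested p y`, for arity `n = p + 1 + q`, where the
`p`-th child contributes one more than the sum over its own children. -/
theorem sum_nested (G : ℕ → ℕ) (p q : ℕ) :
    ∑ j ∈ Finset.range (p + 1 + q), (if j < p then G j
      else if j = p then 1 + ∑ k ∈ Finset.range (p + 1 + q), G (p + k) else G (j + (p + q))) =
      1 + ∑ i ∈ Finset.range (p + (p + 1 + q) + q), G i := by
  rw [Finset.sum_range_add _ (p + 1) q, Finset.sum_range_succ, Finset.sum_range_add G _ q,
    Finset.sum_range_add G p]
  rw [Finset.sum_congr rfl fun j hj => if_pos (Finset.mem_range.1 hj),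
    Finset.sum_congr (s₁ := Finset.range q) rfl fun j _ =>
      (if_neg (by omega)).trans (if_neg (by omega))]
  simp only [lt_irrefl, if_false, if_true]
  rw [Finset.sum_congr (s₁ := Finset.range q) rfl fun j _ =>
    congrArg G (show p + 1 + j + (p + q) = p + (p + 1 + q) + j by omega)]
  ring

/-- The number of inner vertices of `nested p y` does not depend on `p`: rotations preserve it. -/
theorem numNodes_nested (p : Fin n) (y : Fin (2 * n - 1) → NTree n) :
    (nested p y).numNodes = 2 + ∑ j, (y j).numNodes := by
  obtain ⟨p, hp⟩ := p
  obtain ⟨q, rfl⟩ := Nat.exists_eq_add_of_le (Nat.succ_le_of_lt hp)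
  -- The numbers of inner vertices of the trees `y j`, extended by `0` to all indices.
  let G : ℕ → ℕ := fun i => if h : i < 2 * (p + 1 + q) - 1 then (y ⟨i, h⟩).numNodes else 0
  have hG : ∀ i (h : i < 2 * (p + 1 + q) - 1), (y ⟨i, h⟩).numNodes = G i :=
    fun i h => by simp [G, h]
  have key := sum_nested G p q
  rw [← Fin.sum_univ_eq_sum_range, show p + (p + 1 + q) + q = 2 * (p + 1 + q) - 1 by omega,
    ← Fin.sum_univ_eq_sum_range, ← Fin.sum_univ_eq_sum_range] at key
  rw [nested, numNodes, ← Finset.sum_congr rfl fun (j : Fin (2 * (p + 1 + q) - 1)) _ =>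
    (hG j j.2).symm]
  refine (congrArg (1 + ·) ((Finset.sum_congr rfl fun j _ => ?_).trans key)).trans (by ring)
  simp only [Fin.lt_def, Fin.ext_iff]
  split_ifs with h₁ h₂
  · exact hG _ _
  · simp only [numNodes, hG]
  · rw [hG]
    congr 1
    omega

/-- The right comb with a given number of inner vertices: each inner vertex but the first is the
last child of the previous one. -/
def comb (n : ℕ) : ℕ → NTree n
  | 0 => leaf
  | k + 1 => node fun j => if j.1 = n - 1 then comb n k else leaf

theorem numNodes_comb [NeZero n] (k : ℕ) : (comb n k).numNodes = k := by
  have hn := NeZero.pos n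
  induction k with
  | zero => rfl
  | succ k ih =>
    rw [comb, numNodes, Finset.sum_eq_single (⟨n - 1, by omega⟩ : Fin n)]
    · simp [ih, add_comm]
    · intro j _ hj
      rw [if_neg fun e => hj (Fin.ext e)]
      rfl
    · simp

end NTree

/-! ### Connecting trees by rotations -/

section Rotation

variable {n : ℕ} {V : Type*}

/-- One term is connected to another if some generators of the structure monoid, applied in
succession, map the first to the second. -/
def Connected (x : Fin (2 * n - 1) ↪ V) :
    (tensorLanguage n).Term V → (tensorLanguage n).Term V → Prop :=
  Relation.ReflTransGen fun a b => ∃ ρ ∈ (catalanTheory n x).generators, ρ.Maps a b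

theorem Connected.exists_maps {x : Fin (2 * n - 1) ↪ V} {a b : (tensorLanguage n).Term V}
    (h : Connected x a b) : ∃ ρ : (catalanTheory n x).Struct, ρ.1.Maps a b := by
  induction h with
  | refl => exact ⟨1, PartialEndo.maps_one.2 rfl⟩
  | tail _ h ih =>
    obtain ⟨ρ, hρ⟩ := ih
    obtain ⟨τ, hτ, hτ'⟩ := h
    exact ⟨ρ * ⟨τ, Submonoid.subset_closure hτ⟩, PartialEndo.maps_mul.2 ⟨_, hρ, hτ'⟩⟩

theorem Connected.symm {x : Fin (2 * n - 1) ↪ V} {a b : (tensorLanguage n).Term V}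
    (h : Connected x a b) : Connected x b a := by
  suffices Std.Symm fun a b => ∃ ρ ∈ (catalanTheory n x).generators, ρ.Maps a b from
    Std.Symm.symm (r := Relation.ReflTransGen _) _ _ h
  refine ⟨?_⟩
  rintro a b ⟨_, ⟨s, t, α, hst, rfl⟩, h⟩
  rw [BalancedTheory.maps_translatedOp _ hst] at h
  exact ⟨_, ⟨t, s, α, hst.symm, rfl⟩, (BalancedTheory.maps_translatedOp _ hst.symm _ _ _).2
    (h.swap fun _ _ ⟨φ, h₁, h₂⟩ => ⟨φ, h₂, h₁⟩)⟩

theorem Connected.update {x : Fin (2 * n - 1) ↪ V} {ts : Fin n → (tensorLanguage n).Term V}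
    {i : Fin n} {b : (tensorLanguage n).Term V} (h : Connected x (ts i) b) :
    Connected x (tensor ts) (tensor (Function.update ts i b)) := by
  have : Connected x (tensor (Function.update ts i (ts i))) (tensor (Function.update ts i b)) :=
    Relation.ReflTransGen.lift (fun c => tensor (Function.update ts i c))
    (r := fun a b => ∃ ρ ∈ (catalanTheory n x).generators, ρ.Maps a b)
    (p := fun a b => ∃ ρ ∈ (catalanTheory n x).generators, ρ.Maps a b) (by
      rintro c d ⟨_, ⟨s, t, α, hst, rfl⟩, h⟩
      rw [BalancedTheory.maps_translatedOp _ hst] at h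
      refine ⟨_, ⟨s, t, ⟨n, TensorSymbol.tensor, i⟩ :: α, hst, rfl⟩,
        (BalancedTheory.maps_translatedOp _ hst _ _ _).2 ?_⟩
      have := TranslatedGraph.step (L := tensorLanguage n)
        (TensorSymbol.tensor : TensorSymbol n n) i (Function.update ts i c) (b := d) (by simpa using h)
      rwa [Function.update_idem] at this) _ _ h
  rwa [Function.update_eq_self] at this

/-- Two trees are connected if the terms obtained from them by labelling all leaves with the same
variable `z` are. -/
def TreeConnected (x : Fin (2 * n - 1) ↪ V) (z : V) (S T : NTree n) : Prop :=
  Connected x (graft S fun _ => .var z) (graft T fun _ => .var z)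

theorem TreeConnected.symm {x : Fin (2 * n - 1) ↪ V} {z : V} {S T : NTree n}
    (h : TreeConnected x z S T) : TreeConnected x z T S :=
  Connected.symm h

theorem TreeConnected.trans {x : Fin (2 * n - 1) ↪ V} {z : V} {S T U : NTree n}
    (h : TreeConnected x z S T) (h' : TreeConnected x z T U) : TreeConnected x z S U :=
  Relation.ReflTransGen.trans h h'

theorem TreeConnected.update {x : Fin (2 * n - 1) ↪ V} {z : V} {c : Fin n → NTree n} {i : Fin n}
    {T : NTree n} (h : TreeConnected x z (c i) T) :
    TreeConnected x z (.node c) (.node (Function.update c i T)) := by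
  have := Connected.update (ts := fun i => graft (c i) fun _ => .var z) h
  have hT : (graft (.node (Function.update c i T)) fun _ => .var z) =
      tensor (Function.update (fun i => graft (c i) fun _ => .var z) i
        (graft T fun _ => .var z)) :=
    congrArg tensor <| funext fun j => by
      by_cases hj : j = i
      · subst hj; simp
      · simp [hj]
  exact (congrArg (Connected x _) hT).mpr this

theorem graft_nested (x : Fin (2 * n - 1) ↪ V) (z : V) (p : Fin n)
    (y : Fin (2 * n - 1) → NTree n) :
    graft (NTree.nested p y) (fun _ => .var z) = (nestedTensor x p).subst
      (Function.extend x (fun j => graft (y j) fun _ => .var z) .var) := by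
  rw [NTree.nested, graft, nestedTensor, subst_tensor]
  congr 1
  funext j
  split_ifs
  · exact (x.injective.extend_apply (fun j => graft (y j) fun _ => .var z) .var _).symm
  · rw [graft, subst_tensor]
    congr 1
    funext k
    exact (x.injective.extend_apply (fun j => graft (y j) fun _ => .var z) .var _).symm
  · exact (x.injective.extend_apply (fun j => graft (y j) fun _ => .var z) .var _).symm

/-- Each equation of `C_n` moves the inner vertex by one position, hence to any position. -/
theorem treeConnected_nested (x : Fin (2 * n - 1) ↪ V) (z : V) (p q : Fin n)
    (y : Fin (2 * n - 1) → NTree n) :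
    TreeConnected x z (NTree.nested p y) (NTree.nested q y) := by
  suffices ∀ k (hk : k < n),
      TreeConnected x z (NTree.nested ⟨k, hk⟩ y) (NTree.nested ⟨0, by omega⟩ y) from
    (this p p.2).trans (this q q.2).symm
  intro k hk
  induction k with
  | zero => exact .refl
  | succ k ih =>
    refine Relation.ReflTransGen.trans (.single ?_) (ih (by omega))
    have hst : (nestedTensor x ⟨k + 1, hk⟩, nestedTensor x ⟨k, by omega⟩) ∈
        (catalanTheory n x).eqns := ⟨k + 1, by omega, hk, rfl⟩
    refine ⟨_, ⟨_, _, [], .inl hst, rfl⟩, ((catalanTheory n x).maps_translatedOp (.inl hst) _ _ _).2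
      (.root ?_)⟩
    exact ⟨_, (graft_nested x z _ y).symm, (graft_nested x z _ y).symm⟩

/-- Every tree is connected to the right comb with the same number of inner vertices: if the
first child of the root that is not a leaf is not the last child, it can be combed by induction,
and a rotation then makes all children of the root but the last one leaves; the last one can be
combed by induction. -/
theorem treeConnected_comb [NeZero n] (x : Fin (2 * n - 1) ↪ V) (z : V) (T : NTree n) :
    TreeConnected x z T (NTree.comb n T.numNodes) := by
  have hn := NeZero.pos n
  induction hN : T.numNodes using Nat.strong_induction_on generalizing T with
  | _ N ih =>
    let last : Fin n := ⟨n - 1, by omega⟩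
    have hlt : ∀ (c : Fin n → NTree n), (NTree.node c).numNodes = N → ∀ i,
        (c i).numNodes < N := fun c hc i => by
      have := Finset.single_le_sum (f := fun i => (c i).numNodes) (fun _ _ => Nat.zero_le _)
        (Finset.mem_univ i)
      rw [NTree.numNodes] at hc
      omega
    -- The case where all children of the root but the last one are leaves.
    have spine : ∀ c : Fin n → NTree n, (NTree.node c).numNodes = N →
        (∀ j, j ≠ last → c j = .leaf) → TreeConnected x z (.node c) (NTree.comb n N) := by
      intro c hc hleaf
      have hN' : N = (c last).numNodes + 1 := by
        rw [← hc, NTree.numNodes, Finset.sum_eq_single last, add_comm]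
        · intro j _ hj
          rw [hleaf j hj, NTree.numNodes]
        · simp
      have := (ih _ (hlt c hc last) (c last) rfl).update
      rw [hN', NTree.comb]
      convert this using 2
      funext j
      by_cases hj : j = last
      · subst hj; simp [last]
      · rw [Function.update_of_ne hj, hleaf j hj, if_neg fun e => hj (Fin.ext e)]
    cases T with
    | leaf =>
      obtain rfl : 0 = N := hN
      exact .refl
    | node c =>
      by_cases hall : ∀ j, j ≠ last → c j = .leaf
      · exact spine c hN hall
      push Not at hall
      have hex : ∃ k, ∃ hk : k < n, c ⟨k, hk⟩ ≠ .leaf := by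
        obtain ⟨j, -, hj⟩ := hall
        exact ⟨j, j.2, hj⟩
      classical
      obtain ⟨hp, hcp⟩ := Nat.find_spec hex
      have hmin : ∀ j : Fin n, j.1 < Nat.find hex → c j = .leaf := fun j hj => by
        by_contra h
        exact Nat.find_min hex hj ⟨j.2, h⟩
      have hp' : Nat.find hex < n - 1 := by
        obtain ⟨j, hj, hj'⟩ := hall
        have h₁ : Nat.find hex ≤ j.1 := Nat.find_min' hex ⟨j.2, hj'⟩
        have h₂ : j.1 ≠ n - 1 := fun e => hj (Fin.ext e)
        omega
      -- From here on, `p` is the position of the first child that is not a leaf.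
      generalize Nat.find hex = p at hp hcp hmin hp'
      obtain ⟨m, hm⟩ : ∃ m, (c ⟨p, hp⟩).numNodes = m + 1 := by
        cases h : c ⟨p, hp⟩ with
        | leaf => exact absurd h hcp
        | node d => exact ⟨_, by rw [NTree.numNodes, add_comm]⟩
      have hcomb := (ih _ (hlt c hN ⟨p, hp⟩) (c ⟨p, hp⟩) rfl).update (c := c)
      rw [hm] at hcomb
      refine hcomb.trans ?_
      obtain ⟨y, hy, hy₁, hy₂⟩ := NTree.exists_eq_nested (p := ⟨p, hp⟩)
        (c := Function.update c ⟨p, hp⟩ (NTree.comb n (m + 1)))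
        ((Function.update_self _ _ _).trans (NTree.comb.eq_2 n m))
      have hNy : (NTree.nested ⟨p, hp⟩ y).numNodes = N := by
        rw [← hy, ← hN, NTree.numNodes, NTree.numNodes]
        congr 1
        refine Finset.sum_congr rfl fun j _ => ?_
        by_cases hj : j = ⟨p, hp⟩
        · subst hj
          rw [Function.update_self, NTree.numNodes_comb, hm]
        · rw [Function.update_of_ne hj]
      rw [hy]
      refine (treeConnected_nested x z _ last y).trans (spine _ ?_ fun j hj => ?_)
      · rw [NTree.numNodes_nested] at hNy
        exact (NTree.numNodes_nested _ _).trans hNy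
      · have hj' : j.1 < n - 1 := by
          have : j.1 ≠ n - 1 := fun e => hj (Fin.ext e)
          omega
        rw [if_pos (show j < last from hj')]
        by_cases hjp : j.1 < p
        · rw [hy₁ _ hjp j.2, Function.update_of_ne (fun e => hjp.ne (congrArg Fin.val e))]
          exact hmin j hjp
        · rw [hy₂ ⟨j, by omega⟩ (not_lt.1 hjp) (by dsimp only; omega)]
          exact if_neg (by dsimp only; omega)

end Rotation

/-! ### The isomorphism -/

section Isomorphism

variable {n : ℕ} {V : Type*}

/-- Every element of `F_{n,1}` is the symbol of the diagram of an element of the structure monoid: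
that of an element which maps a term with source tree `T₁` to a term with tree `T₂`. -/
theorem exists_represents_symbol (hn : 2 ≤ n) (x : Fin (2 * n - 1) ↪ V) {D : TreeDiagram n}
    (hD : D.OrderPreserving) : ∃ (ρ : (catalanTheory n x).Struct) (E : TreeDiagram n),
      E.Represents ρ.1 ∧
        HigmanThompson.symbol E.src E.tgt E.σ = HigmanThompson.symbol D.src D.tgt D.σ := by
  have : NeZero n := ⟨by omega⟩
  let z := x ⟨0, by omega⟩
  have hnodes := NTree.numNodes_eq_of_card_eq hn (Nat.card_congr D.σ)
  have hcon : TreeConnected x z D.src D.tgt :=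
    (hnodes ▸ treeConnected_comb x z D.src).trans (treeConnected_comb x z D.tgt).symm
  obtain ⟨ρ, hρ⟩ := Connected.exists_maps hcon
  obtain ⟨E, hE⟩ := exists_represents x ρ
  refine ⟨ρ, E, hE, ?_⟩
  have hgraph := (hE.2 _ _).1 hρ
  have hsrc : termTree (graft D.src fun _ => .var z) = D.src := termTree_graft_var _ _
  obtain ⟨E', hEE', hE'⟩ := E.exists_expands_src (hsrc ▸ hgraph.covers_src.expands)
  have hleaf : ∀ l ∈ E'.src.leafSet, ∃ y, subtermAt l (graft D.src fun _ => .var z) =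
      some (FirstOrder.Language.Term.var y) := fun l hl =>
    mem_leafSet_termTree.1 (by rwa [hsrc, ← hE'])
  have hgraph' := hEE'.graph_iff.2 ⟨hgraph, fun l hl => ⟨_, (hleaf l hl).choose_spec⟩⟩
  have htgt : E'.tgt = D.tgt := by
    refine (eq_termTree fun w hw => ?_).trans (termTree_graft_var D.tgt fun _ => z)
    obtain ⟨l, hl⟩ := E'.σ.surjective ⟨w, hw⟩
    obtain ⟨c, h₁, h₂⟩ := hgraph' l
    obtain ⟨y, hy⟩ := hleaf l l.2
    rw [hl, ← h₁, hy] at h₂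
    exact ⟨y, h₂⟩
  rw [HigmanThompson.symbol_eq_of_expands hEE',
    (hEE'.orderPreserving hE.1).ext hD hE' htgt]

/-- The homomorphism from the structure monoid to `F_{n,1}` that maps an element to the symbol of
its diagram. -/
noncomputable def structSymbol [NeZero n] [Infinite V] (x : Fin (2 * n - 1) ↪ V) :
    (catalanTheory n x).Struct →* BrownThompson n where
  toFun ρ := ⟨HigmanThompson.symbol _ _ (exists_represents x ρ).choose.σ,
    _, _, _, (exists_represents x ρ).choose_spec.1, rfl⟩
  map_one' := Subtype.ext (by
    exact congrArg (fun D : TreeDiagram n => HigmanThompson.symbol D.src D.tgt D.σ)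
      ((exists_represents x 1).choose_spec.unique TreeDiagram.represents_one))
  map_mul' ρ τ := Subtype.ext (by
    obtain ⟨F, hF, hF'⟩ := (exists_represents x ρ).choose_spec.exists_mul
      (exists_represents x τ).choose_spec
    exact (congrArg (fun D : TreeDiagram n => HigmanThompson.symbol D.src D.tgt D.σ)
      ((exists_represents x (ρ * τ)).choose_spec.unique hF)).trans hF')

theorem structSymbol_eq [NeZero n] [Infinite V] {x : Fin (2 * n - 1) ↪ V}
    {ρ : (catalanTheory n x).Struct} {D : TreeDiagram n} (hD : D.Represents ρ.1) :
    (structSymbol x ρ : HigmanThompson n) = HigmanThompson.symbol D.src D.tgt D.σ :=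
  congrArg (fun D : TreeDiagram n => HigmanThompson.symbol D.src D.tgt D.σ)
    ((exists_represents x ρ).choose_spec.unique hD)

/-- The homomorphism from the structure group to `F_{n,1}` induced by `structSymbol`. -/
noncomputable def structGroupSymbol [NeZero n] [Infinite V] (x : Fin (2 * n - 1) ↪ V) :
    (catalanTheory n x).StructGroup →* BrownThompson n :=
  (catalanTheory n x).idempotentCon.lift (structSymbol x) <| Con.conGen_le.2 <| by
    rintro a _ ⟨ha, rfl⟩
    refine (Con.ker_rel _).2 ?_
    rw [map_one]
    exact mul_eq_left.1 ((map_mul _ _ _).symm.trans (congrArg (structSymbol x) ha))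

theorem structGroupSymbol_bijective (hn : 2 ≤ n) [NeZero n] [Infinite V]
    (x : Fin (2 * n - 1) ↪ V) : Function.Bijective (structGroupSymbol x) := by
  constructor
  · refine (injective_iff_map_eq_one (structGroupSymbol x)).2 fun q hq => ?_
    obtain ⟨ρ, rfl⟩ := (catalanTheory n x).toStructGroup_surjective q
    obtain ⟨D, hD⟩ := exists_represents x ρ
    refine (catalanTheory n x).toStructGroup_idempotent ρ (Subtype.ext (hD.isIdempotentElem ?_))
    rw [← structSymbol_eq hD]
    exact congrArg Subtype.val hq
  · rintro ⟨_, A, B, σ, hσ, rfl⟩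
    obtain ⟨ρ, E, hE, h⟩ := exists_represents_symbol hn x (D := ⟨A, B, σ⟩) hσ
    exact ⟨(catalanTheory n x).toStructGroup ρ, Subtype.ext ((structSymbol_eq hE).trans h)⟩

end Isomorphism

theorem mainTheorem5 (n : ℕ) (hn : 2 ≤ n) {V : Type*} [Infinite V] (x : Fin (2 * n - 1) ↪ V) :
    (∀ ρ : (catalanTheory n x).Struct, ∃ s t : (tensorLanguage n).Term V,
      IsSeed (ρ : PartialEndo ((tensorLanguage n).Term V)) s t) ∧
    ∃ Θ : (catalanTheory n x).StructGroup ≃* BrownThompson n,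
      ∀ (ρ : (catalanTheory n x).Struct) (s t : (tensorLanguage n).Term V),
        IsSeed (ρ : PartialEndo ((tensorLanguage n).Term V)) s t →
          ∃ σ : (termTree s).Leaf ≃o (termTree t).Leaf,
            (Θ ((catalanTheory n x).toStructGroup ρ) : HigmanThompson n) =
              HigmanThompson.symbol (termTree s) (termTree t) σ.toEquiv := by
  have : NeZero n := ⟨by omega⟩
  refine ⟨fun ρ => ?_, MulEquiv.ofBijective _ (structGroupSymbol_bijective hn x),
    fun ρ s t hst => ?_⟩
  · obtain ⟨D, hD⟩ := exists_represents x ρ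
    obtain ⟨s, t, -, -, hst⟩ := D.exists_substGraph_iff (V := V)
    exact ⟨s, t, fun a b => (hD.2 a b).trans (hst a b).symm⟩
  · obtain ⟨D, hD⟩ := exists_represents x ρ
    obtain ⟨hs, ht⟩ := hD.termTree_eq hst
    rw [hs, ht]
    exact ⟨hD.1.orderIso, structSymbol_eq hD⟩
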